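/- Let $F$ be a finite extension of $\mathbb{Q}_2$ with ring of integers $\mathcal{O}$, maximal ideal $\mathfrak{p}$, residue field $k$ of order $q$, and a fixed uniformizer $\varpi$. Regard $k^\times$ as the subgroup of $F^\times$ of elements of finite order prime to $2$ (Teichmüller lift). Let $n\ge 1$ and $N=2n+1$. Let $Z$ be the center of $\mathrm{GL}_N(F)$, and let $I^+\subset\mathrm{GL}_N(F)$ be the subgroup of matrices with diagonal entries in $1+\mathfrak{p}$, entries above the diagonal in $\mathcal{O}$ and entries below the diagonal in $\mathfrak{p}$. For $b\in k^\times$ put $$\varphi_b=\begin{pmatrix}0&I_{N-1}\\ \varpi b&0\end{pmatrix}\in\mathrm{GL}_N(F).$$ Let $\theta(g)=J\,{}^{t}g^{-1}J^{-1}$, where $J$ is the anti-diagonal $N\times N$ matrix whose $(i,N+1-i)$ entry is $(-1)^{i-1}$. Call $x=(x_{ij})\in I^+$ *$\theta$-affine generic* if $x_{j,j+1}+x_{2n+1-j,2n+2-j}\in\mathcal{O}^\times$ for $1\le j\le n$ and $x_{2n+1,1}\in\mathfrak{p}\smallsetminus\mathfrak{p}^2$. Put $$T^\theta(q)=\{\mathrm{diag}(t_1,\dots,t_n,1,t_n^{-1},\dots,t_1^{-1})\mid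 t_i\in k^\times\}.$$ Let $a\in k^\times$ and let $x\in I^+$ be $\theta$-affine generic. If $g\in\mathrm{GL}_N(F)$ satisfies $g\,x\,\theta(g)^{-1}\in Z I^+\langle\varphi_{a^{-1}}\rangle$, then $$g\in Z I^+\langle\varphi_{a^{-1}}\rangle\, T^\theta(q),$$ that is, $g=ht$ with $h\in ZI^+\langle\varphi_{a^{-1}}\rangle$ and $t\in T^\theta(q)$. -/

import Mathlib

open scoped Pointwise ValuativeRel MatrixGroups

noncomputable section

namespace ThetaNorm

section Field

variable (F : Type*) [Field F] [ValuativeRel F]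

/-- The fractional ideal `𝔭 ^ m` (`m ≥ 0`), as a subset of `F`; for `m = 0` it is the ring of
integers `𝒪`. -/
def primePow (m : ℕ) : Set F :=
  (fun y : 𝒪[F] => (y : F)) '' ((𝓂[F] ^ m : Ideal 𝒪[F]) : Set 𝒪[F])

/-- The set `𝒪ˣ` of units of the ring of integers, as a subset of `F`. -/
def integerUnits : Set F :=
  Set.range fun u : 𝒪[F]ˣ => ((u : 𝒪[F]) : F)

/-- The group `kˣ`, regarded inside `Fˣ` by the Teichmüller lift: the elements of finite order
prime to the residue characteristic. -/
def teichmullerUnits : Subgroup Fˣ where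
  carrier := {u | IsOfFinOrder u ∧ (orderOf u).Coprime (ringChar 𝓀[F])}
  one_mem' := by simp
  mul_mem' := by
    rintro u v ⟨hu, hu'⟩ ⟨hv, hv'⟩
    refine ⟨(Commute.all u v).isOfFinOrder_mul hu hv, ?_⟩
    exact Nat.Coprime.coprime_dvd_left (Commute.all u v).orderOf_mul_dvd_mul_orderOf
      (Nat.Coprime.mul_left hu' hv')
  inv_mem' := by
    rintro u ⟨hu, hu'⟩
    exact ⟨hu.inv, by simpa using hu'⟩

variable {F}

/-- `ϖ` is a uniformizer: it lies in `𝒪` and generates the maximal ideal, i.e. it is irreducible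
in `𝒪`. -/
def IsUniformizer (ϖ : F) : Prop :=
  ∃ y : 𝒪[F], Irreducible y ∧ (y : F) = ϖ

end Field

section Groups

variable {F : Type*} [Field F]

/-- The anti-diagonal matrix `J_N`, whose (one-based) `(i, N + 1 - i)` entry is `(-1) ^ (i - 1)`. -/
def antiDiagMatrix (F : Type*) [Field F] (N : ℕ) : Matrix (Fin N) (Fin N) F :=
  Matrix.of fun i j => if j = Fin.rev i then (-1) ^ (i : ℕ) else 0

theorem antiDiagMatrix_mul_transpose (F : Type*) [Field F] (N : ℕ) :
    antiDiagMatrix F N * (antiDiagMatrix F N).transpose = 1 := by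
  ext i j
  rw [Matrix.mul_apply, Finset.sum_eq_single (Fin.rev i)]
  · by_cases h : i = j
    · subst h
      simp [antiDiagMatrix, ← mul_pow]
    · simp [antiDiagMatrix, h]
  · intro b _ hb
    simp [antiDiagMatrix, hb]
  · simp

/-- `J_N` as an element of `GL_N(F)`. -/
def antiDiag (F : Type*) [Field F] (N : ℕ) : GL (Fin N) F where
  val := antiDiagMatrix F N
  inv := (antiDiagMatrix F N).transpose
  val_inv := antiDiagMatrix_mul_transpose F N
  inv_val := mul_eq_one_comm.mp (antiDiagMatrix_mul_transpose F N)

/-- The inverse transpose `ᵗg⁻¹`. -/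
def invTranspose {N : ℕ} (g : GL (Fin N) F) : GL (Fin N) F where
  val := (g⁻¹).val.transpose
  inv := g.val.transpose
  val_inv := by rw [← Matrix.transpose_mul, Units.mul_inv, Matrix.transpose_one]
  inv_val := by rw [← Matrix.transpose_mul, Units.inv_mul, Matrix.transpose_one]

/-- The involution `θ(g) = J ᵗg⁻¹ J⁻¹` of `GL_N(F)`. -/
def theta {N : ℕ} (g : GL (Fin N) F) : GL (Fin N) F :=
  antiDiag F N * invTranspose g * (antiDiag F N)⁻¹

/-- The `N × N` matrix with ones on the superdiagonal, `c` in the lower-left corner and zeros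
elsewhere. -/
def cyclicMatrix (N : ℕ) (c : F) : Matrix (Fin N) (Fin N) F :=
  Matrix.of fun i j =>
    if (i : ℕ) + 1 = j then 1 else if (i : ℕ) + 1 = N ∧ (j : ℕ) = 0 then c else 0

theorem cyclicMatrix_mul_transpose (N : ℕ) (c : Fˣ) :
    cyclicMatrix N (c : F) * (cyclicMatrix N ((c⁻¹ : Fˣ) : F)).transpose = 1 := by
  ext i j
  have hi := i.isLt
  have hj := j.isLt
  by_cases h : (i : ℕ) + 1 < N
  · rw [Matrix.mul_apply, Finset.sum_eq_single ⟨(i : ℕ) + 1, h⟩]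
    · by_cases hij : i = j
      · subst hij
        simp [cyclicMatrix]
      · have hij' : (j : ℕ) ≠ i := fun e => hij (Fin.ext e.symm)
        simp [cyclicMatrix, hij, hij']
    · intro b _ hb
      have hb' : ¬ (i : ℕ) + 1 = b := fun e => hb (Fin.ext e.symm)
      simp [cyclicMatrix, hb', h.ne]
    · simp
  · have hN : (i : ℕ) + 1 = N := by omega
    rw [Matrix.mul_apply, Finset.sum_eq_single ⟨0, by omega⟩]
    · by_cases hij : i = j
      · subst hij
        have hN0 : N ≠ 0 := by omega
        simp [cyclicMatrix, hN, hN0]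
      · have hij' : ¬ (j : ℕ) + 1 = N := fun e => hij (Fin.ext (by omega))
        simp [cyclicMatrix, hij, hij']
    · intro b _ hb
      have hb0 : (b : ℕ) ≠ 0 := fun e => hb (Fin.ext e)
      have hb' : ¬ (i : ℕ) + 1 = b := by have := b.isLt; omega
      simp [cyclicMatrix, hb', hb0]
    · simp

/-- The element `φ_a` of `GL_N(F)`, with ones on the superdiagonal, `ϖ a` in the lower-left corner
and zeros elsewhere. -/
def phi (N : ℕ) (ϖ a : Fˣ) : GL (Fin N) F where
  val := cyclicMatrix N ((ϖ * a : Fˣ) : F)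
  inv := (cyclicMatrix N (((ϖ * a)⁻¹ : Fˣ) : F)).transpose
  val_inv := cyclicMatrix_mul_transpose N (ϖ * a)
  inv_val := mul_eq_one_comm.mp (cyclicMatrix_mul_transpose N (ϖ * a))

variable [ValuativeRel F]

/-- The pro-`p` Iwahori subgroup `I⁺` of `GL_N(F)`: entries in `1 + 𝔭` on the diagonal, in `𝒪`
above it, and in `𝔭` below it. -/
def iwahoriPlus (F : Type*) [Field F] [ValuativeRel F] (N : ℕ) : Set (GL (Fin N) F) :=
  {g | (∀ i, g.val i i - 1 ∈ primePow F 1) ∧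
    (∀ i j, i < j → g.val i j ∈ primePow F 0) ∧
    (∀ i j, j < i → g.val i j ∈ primePow F 1)}

/-- The product set `Z I⁺ ⟨φ_a⟩` in `GL_N(F)`, where `Z` is the center. -/
def extIwahoriPlus (N : ℕ) (ϖ a : Fˣ) : Set (GL (Fin N) F) :=
  (Subgroup.center (GL (Fin N) F) : Set (GL (Fin N) F)) * iwahoriPlus F N *
    (Subgroup.zpowers (phi N ϖ a) : Set (GL (Fin N) F))

/-- The vector `(t_1, …, t_n, 1, t_n⁻¹, …, t_1⁻¹)`. -/
def thetaVec {n : ℕ} (t : Fin n → Fˣ) (i : Fin (2 * n + 1)) : Fˣ :=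
  if h : (i : ℕ) < n then t ⟨i, h⟩
  else if h' : (i : ℕ) = n then 1
  else (t ⟨2 * n - i, by omega⟩)⁻¹

/-- The set `T^θ(q)` of the matrices `diag(t_1, …, t_n, 1, t_n⁻¹, …, t_1⁻¹)` with all `t_i`
Teichmüller units. -/
def thetaTorus (F : Type*) [Field F] [ValuativeRel F] (n : ℕ) : Set (GL (Fin (2 * n + 1)) F) :=
  {g | ∃ t : Fin n → Fˣ, (∀ i, t i ∈ teichmullerUnits F) ∧
    g.val = Matrix.diagonal fun i => (thetaVec t i : F)}

/-- `x ∈ I⁺` is `θ`-affine generic. In one-based indices: `x_{j,j+1} + x_{2n+1-j,2n+2-j} ∈ 𝒪ˣ` for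
`1 ≤ j ≤ n`, and `x_{2n+1,1} ∈ 𝔭 ∖ 𝔭²`. Here `i = j - 1`. -/
def IsThetaAffineGeneric (n : ℕ) (x : GL (Fin (2 * n + 1)) F) : Prop :=
  x ∈ iwahoriPlus F (2 * n + 1) ∧
  (∀ i : Fin n,
    x.val ⟨i, by omega⟩ ⟨i + 1, by omega⟩ +
      x.val ⟨2 * n - 1 - i, by omega⟩ ⟨2 * n - i, by omega⟩ ∈ integerUnits F) ∧
  x.val (Fin.last (2 * n)) 0 ∈ primePow F 1 \ primePow F 2

end Groups

end ThetaNorm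

end

/-! Filter the matrix algebra by giving an entry `M i j` the degree `N * ord (M i j) + j - i`. Then
`I⁺` is the group of elements that are 1 modulo degree 1, `φ` has degree 1 and `φ⁻¹` degree -1, and
`θ(g)⁻¹ = tau g`, where `tau` is an anti-involution preserving degrees.

By the affine Bruhat decomposition (`exists_monomial`), `g = u₁⁻¹ m u₂⁻¹` with `m` monomial and `u₁,
u₂ ∈ I⁺`. Twisted conjugation by `u₂⁻¹` keeps `x` generic: to first order it adds `A + tau A`, which
cancels in the superdiagonal sums and adds twice an element of `𝔭` in the corner, negligible because
`2 ∈ 𝔭`. So `m` carries a generic `x'` to an element `z w φ^k` of exact degree `K`.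

Let `C a` be the degree of the nonzero entry of `m` in column `a`. Diagonal entries, used for `x'`
and its inverse, give `C a + C (rev a) = K`. The superdiagonal units give `C (a+1) ≤ C a + 1`, with
equality excluded because `a - C a` is injective; hence `C` is antitone. The corner bounds `C` below
at the last index. Since `N` is odd there is a middle index, and all this forces `C` to be a
constant `L` with `K = 2L` (`exists_hasDeg_of_generic`).

Now `D = φ^(-L) m` has degree 0. As `2 ∈ 𝔭`, `tau φ` agrees with `φ` modulo `I⁺`, so `D x' θ(D)⁻¹`
is a unit scalar `ζ` times an element of `I⁺`. Comparing diagonals, `d_i d_(rev i) ≡ ζ`; dividing by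
the middle entry and taking Teichmüller lifts yields the torus factor (`exists_thetaTorus_of_diag`).
-/

namespace ThetaNorm

/-! ### The normalized valuation and Teichmüller representatives. -/

section Ord

variable {F : Type*} [Field F] [ValuativeRel F] [TopologicalSpace F]
  [IsNonarchimedeanLocalField F]

/-- The normalized additive valuation of a local field, with the junk value `ord 0 = 0`. -/
noncomputable def ord (y : F) : ℤ :=
  -WithZero.log (IsNonarchimedeanLocalField.valueGroupWithZeroIsoInt F
    (ValuativeRel.valuation F y))

theorem ord_mul {y z : F} (hy : y ≠ 0) (hz : z ≠ 0) : ord (y * z) = ord y + ord z := by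
  unfold ord
  rw [map_mul, map_mul, WithZero.log_mul (by simpa using hy) (by simpa using hz)]
  ring

@[simp] theorem ord_one : ord (1 : F) = 0 := by simp [ord]

@[simp] theorem ord_neg (y : F) : ord (-y) = ord y := by simp [ord, Valuation.map_neg]

theorem ord_inv (y : F) : ord y⁻¹ = -ord y := by simp [ord]

theorem ord_pow (y : F) (m : ℕ) : ord (y ^ m) = m * ord y := by
  simp [ord, WithZero.log_pow]

theorem ord_zpow (y : F) (m : ℤ) : ord (y ^ m) = m * ord y := by
  simp [ord, WithZero.log_zpow]

theorem le_ord_iff {y z : F} (hy : y ≠ 0) (hz : z ≠ 0) :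
    ord y ≤ ord z ↔ ValuativeRel.valuation F z ≤ ValuativeRel.valuation F y := by
  unfold ord
  rw [neg_le_neg_iff, WithZero.log_le_log (by simpa using hz) (by simpa using hy), map_le_map_iff]

theorem le_ord_add {y z : F} {c : ℤ} (hy : y ≠ 0) (hz : z ≠ 0) (hyz : y + z ≠ 0)
    (h₁ : c ≤ ord y) (h₂ : c ≤ ord z) : c ≤ ord (y + z) := by
  rcases le_max_iff.mp ((ValuativeRel.valuation F).map_add y z) with h | h
  · exact h₁.trans ((le_ord_iff hy hyz).mpr h)
  · exact h₂.trans ((le_ord_iff hz hyz).mpr h)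

theorem mem_integer_iff_ord {y : F} (hy : y ≠ 0) : y ∈ 𝒪[F] ↔ 0 ≤ ord y := by
  rw [← ord_one (F := F), le_ord_iff one_ne_zero hy, map_one]
  exact Valuation.mem_integer_iff _ _

theorem isUnit_integer_iff_ord {y : 𝒪[F]} (hy : y ≠ 0) : IsUnit y ↔ ord (y : F) = 0 := by
  have hy' : (y : F) ≠ 0 := by simpa using hy
  constructor
  · rintro ⟨u, rfl⟩
    have h₁ := (mem_integer_iff_ord hy').mp (u : 𝒪[F]).2
    have h₃ : ((u : 𝒪[F]) : F) * ((u⁻¹ : 𝒪[F]ˣ) : 𝒪[F]) = 1 := by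
      rw [← Subring.coe_mul, Units.mul_inv, Subring.coe_one]
    have h₂ := (mem_integer_iff_ord (right_ne_zero_of_mul_eq_one h₃)).mp
      ((u⁻¹ : 𝒪[F]ˣ) : 𝒪[F]).2
    have h₄ := ord_mul hy' (right_ne_zero_of_mul_eq_one h₃)
    rw [h₃, ord_one] at h₄
    omega
  · intro h
    have h' : (y : F)⁻¹ ∈ 𝒪[F] := by
      rw [mem_integer_iff_ord (inv_ne_zero hy'), ord_inv, h, neg_zero]
    exact IsUnit.of_mul_eq_one ⟨_, h'⟩ (Subtype.ext (mul_inv_cancel₀ hy'))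

theorem exists_ord_eq_one : ∃ y : F, y ≠ 0 ∧ ord y = 1 := by
  obtain ⟨y, hy⟩ := ValuativeRel.valuation_surjective
    ((IsNonarchimedeanLocalField.valueGroupWithZeroIsoInt F).symm (WithZero.exp (-1)))
  refine ⟨y, ?_, by simp [ord, hy]⟩
  rintro rfl
  rw [map_zero] at hy
  have := congrArg (IsNonarchimedeanLocalField.valueGroupWithZeroIsoInt F) hy
  simp only [map_zero, OrderMonoidIso.apply_symm_apply] at this
  exact WithZero.exp_ne_zero this.symm

theorem ord_of_irreducible {y : 𝒪[F]} (hy : Irreducible y) : ord (y : F) = 1 := by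
  have hy0 : (y : F) ≠ 0 := by simpa using hy.ne_zero
  have h₀ := (mem_integer_iff_ord hy0).mp y.2
  have h₁ : ord (y : F) ≠ 0 := fun h => hy.1 ((isUnit_integer_iff_ord hy.ne_zero).mpr h)
  -- The generator `y` divides an element of order 1, and the cofactor has nonnegative order, so
  -- `ord y ≤ 1`.
  obtain ⟨w, hw, hw1⟩ := exists_ord_eq_one (F := F)
  have hwO : w ∈ 𝒪[F] := (mem_integer_iff_ord hw).mpr (by omega)
  have hw0 : (⟨w, hwO⟩ : 𝒪[F]) ≠ 0 := fun h => hw (congrArg Subtype.val h)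
  have hwm : (⟨w, hwO⟩ : 𝒪[F]) ∈ 𝓂[F] := by
    rw [IsLocalRing.mem_maximalIdeal, mem_nonunits_iff, isUnit_integer_iff_ord hw0]
    simp [hw1]
  rw [hy.maximalIdeal_eq, Ideal.mem_span_singleton] at hwm
  obtain ⟨c, hc⟩ := hwm
  have hc' : w = (y : F) * (c : F) := congrArg Subtype.val hc
  have hc0 : (c : F) ≠ 0 := fun h => hw (by rw [hc', h, mul_zero])
  have h₂ := (mem_integer_iff_ord hc0).mp c.2
  rw [hc', ord_mul hy0 hc0] at hw1
  omega

theorem mem_primePow_iff {y : F} {m : ℕ} : y ∈ primePow F m ↔ y = 0 ∨ (m : ℤ) ≤ ord y := by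
  obtain ⟨p, hp⟩ := IsDiscreteValuationRing.exists_irreducible 𝒪[F]
  have hp0 : (p : F) ≠ 0 := by simpa using hp.ne_zero
  unfold primePow
  rw [hp.maximalIdeal_eq, Ideal.span_singleton_pow]
  simp only [Set.mem_image, SetLike.mem_coe, Ideal.mem_span_singleton]
  constructor
  · rintro ⟨_, ⟨c, rfl⟩, rfl⟩
    by_cases hc : (c : F) = 0
    · left
      simp [hc]
    · right
      have := (mem_integer_iff_ord hc).mp c.2
      rw [Subring.coe_mul, Subring.coe_pow, ord_mul (pow_ne_zero _ hp0) hc, ord_pow,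
        ord_of_irreducible hp]
      omega
  · rintro (rfl | h)
    · exact ⟨0, dvd_zero _, rfl⟩
    · by_cases hy : y = 0
      · exact ⟨0, dvd_zero _, hy.symm⟩
      have hq : y * ((p : F) ^ m)⁻¹ ∈ 𝒪[F] := by
        rw [mem_integer_iff_ord (mul_ne_zero hy (inv_ne_zero (pow_ne_zero _ hp0))),
          ord_mul hy (inv_ne_zero (pow_ne_zero _ hp0)), ord_inv, ord_pow, ord_of_irreducible hp]
        omega
      refine ⟨p ^ m * ⟨_, hq⟩, dvd_mul_right _ _, ?_⟩
      simp only [Subring.coe_mul, Subring.coe_pow]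
      field_simp

theorem mem_integerUnits_iff {y : F} : y ∈ integerUnits F ↔ y ≠ 0 ∧ ord y = 0 := by
  constructor
  · rintro ⟨u, rfl⟩
    have h : ((u : 𝒪[F]) : F) ≠ 0 := by simp
    exact ⟨h, (isUnit_integer_iff_ord u.ne_zero).mp u.isUnit⟩
  · rintro ⟨h, h'⟩
    have hO : y ∈ 𝒪[F] := (mem_integer_iff_ord h).mpr h'.ge
    have h0 : (⟨y, hO⟩ : 𝒪[F]) ≠ 0 := fun e => h (congrArg Subtype.val e)
    obtain ⟨u, hu⟩ := (isUnit_integer_iff_ord h0).mpr h'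
    exact ⟨u, congrArg Subtype.val hu⟩

theorem ord_of_isUniformizer {ϖ : F} (h : IsUniformizer ϖ) : ord ϖ = 1 := by
  obtain ⟨y, hy, rfl⟩ := h
  exact ord_of_irreducible hy

theorem ord_of_isOfFinOrder {u : Fˣ} (h : IsOfFinOrder u) : ord (u : F) = 0 := by
  obtain ⟨m, hm, h⟩ := isOfFinOrder_iff_pow_eq_one.mp h
  have := ord_pow (u : F) m
  rw [← Units.val_pow_eq_pow_val, h, Units.val_one, ord_one] at this
  rcases mul_eq_zero.mp this.symm with h | h
  · omega
  · exact h

/-- Every unit of the ring of integers is congruent to a Teichmüller unit. -/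
theorem exists_teichmuller {y : F} (hy : y ≠ 0) (hy0 : ord y = 0) :
    ∃ t ∈ teichmullerUnits F, (t : F) - y ∈ primePow F 1 := by
  let := IsTopologicalAddGroup.rightUniformSpace F
  have := isUniformAddGroup_of_addCommGroup (G := F)
  obtain ⟨u, rfl⟩ := mem_integerUnits_iff.mpr ⟨hy, hy0⟩
  have : Fintype 𝓀[F] := Fintype.ofFinite _
  set q := Fintype.card 𝓀[F] with hq
  have hq1 : 1 < q := Fintype.one_lt_card
  have hqk : ((q - 1 : ℕ) : 𝓀[F]) = -1 := by
    rw [Nat.cast_sub hq1.le, hq, FiniteField.cast_card_eq_zero]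
    simp
  have hmk : ∀ z : 𝒪[F], IsLocalRing.residue 𝒪[F] z = 0 ↔ z ∈ 𝓂[F] := fun z =>
    IsLocalRing.residue_eq_zero_iff z
  have hu : IsLocalRing.residue 𝒪[F] (u : 𝒪[F]) ≠ 0 :=
    (u.isUnit.map (IsLocalRing.residue 𝒪[F])).ne_zero
  -- Hensel's lemma for `X ^ (q - 1) - 1`: the root is simple because `q - 1 = -1` in the residue
  -- field. The same congruence makes `q - 1` prime to the residue characteristic.
  obtain ⟨r, hr, hru⟩ := HenselianRing.is_henselian (I := 𝓂[F])
    (Polynomial.X ^ (q - 1) - 1 : Polynomial 𝒪[F])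
    (Polynomial.monic_X_pow_sub_C 1 (by omega)) (u : 𝒪[F])
    (by
      rw [← hmk]
      simp [FiniteField.pow_card_sub_one_eq_one _ hu, hq])
    (by
      have : IsUnit (IsLocalRing.residue 𝒪[F]
          ((Polynomial.X ^ (q - 1) - 1 : Polynomial 𝒪[F]).derivative.eval (u : 𝒪[F]))) := by
        rw [isUnit_iff_ne_zero]
        simp [Polynomial.derivative_X_pow, hqk, hu]
      exact this)
  have hrq : r ^ (q - 1) = 1 := by simpa [sub_eq_zero] using hr
  have hrF : (r : F) ^ (q - 1) = 1 := by rw [← Subring.coe_pow, hrq, Subring.coe_one]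
  have hr0 : (r : F) ≠ 0 := by
    intro h
    rw [h, zero_pow (by omega)] at hrF
    exact zero_ne_one hrF
  have ht : (Units.mk0 (r : F) hr0) ^ (q - 1) = 1 := by
    ext
    simpa using hrF
  refine ⟨Units.mk0 (r : F) hr0,
    ⟨isOfFinOrder_iff_pow_eq_one.mpr ⟨q - 1, by omega, ht⟩, ?_⟩, ?_⟩
  · refine Nat.Coprime.coprime_dvd_left (orderOf_dvd_of_pow_eq_one ht) ?_
    have hp : (ringChar 𝓀[F]).Prime := CharP.char_is_prime 𝓀[F] _
    rw [Nat.coprime_comm, hp.coprime_iff_not_dvd, ← ringChar.spec, hqk]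
    simp
  · exact ⟨r - u, by simpa using hru, by simp⟩

end Ord

/-! ### The Iwahori filtration of the matrix algebra. -/

section Degree

variable {F : Type*} [Field F] [ValuativeRel F] [TopologicalSpace F]
  [IsNonarchimedeanLocalField F] {N : ℕ}

/-- The fractional ideal of the elements `y` with `c ≤ N * ord y`. -/
noncomputable def fil (F : Type*) [Field F] [ValuativeRel F] [TopologicalSpace F]
    [IsNonarchimedeanLocalField F] (N : ℕ) (c : ℤ) : AddSubgroup F where
  carrier := {y | y = 0 ∨ c ≤ N * ord y}
  zero_mem' := Or.inl rfl
  neg_mem' := by simp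
  add_mem' := by
    rintro y z (rfl | hy) (rfl | hz)
    · simp
    · simp [hz]
    · simp [hy]
    · by_cases hy0 : y = 0
      · simp [hy0, hz]
      by_cases hz0 : z = 0
      · simp [hz0, hy]
      by_cases hyz : y + z = 0
      · exact Or.inl hyz
      refine Or.inr ?_
      rcases le_total (ord y) (ord z) with h | h
      · exact hy.trans (mul_le_mul_of_nonneg_left (le_ord_add hy0 hz0 hyz le_rfl h) (by simp))
      · exact hz.trans (mul_le_mul_of_nonneg_left (le_ord_add hy0 hz0 hyz h le_rfl) (by simp))

theorem mem_fil {c : ℤ} {y : F} : y ∈ fil F N c ↔ y = 0 ∨ c ≤ N * ord y := Iff.rfl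

theorem fil_mono {c d : ℤ} (h : c ≤ d) {y : F} (hy : y ∈ fil F N d) : y ∈ fil F N c :=
  hy.imp id h.trans

theorem mul_mem_fil {c d : ℤ} {y z : F} (hy : y ∈ fil F N c) (hz : z ∈ fil F N d) :
    y * z ∈ fil F N (c + d) := by
  by_cases hy0 : y = 0
  · simp [hy0]
  by_cases hz0 : z = 0
  · simp [hz0]
  rw [mem_fil] at *
  refine Or.inr ?_
  rw [ord_mul hy0 hz0, mul_add]
  exact add_le_add (hy.resolve_left hy0) (hz.resolve_left hz0)

/-- The hypotheses say that `e` is the ceiling of `c / N`. This converts degree bounds into powers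
of `𝔭`. -/
theorem mem_fil_iff_le_ord {c e : ℤ} {y : F} (h₁ : N * (e - 1) < c) (h₂ : c ≤ N * e) :
    y ∈ fil F N c ↔ y = 0 ∨ e ≤ ord y := by
  rw [mem_fil]
  refine or_congr_right ⟨fun h => ?_, fun h => h₂.trans (mul_le_mul_of_nonneg_left h (by simp))⟩
  have := lt_of_mul_lt_mul_left (h₁.trans_le h) (by simp : (0 : ℤ) ≤ N)
  omega

theorem mem_fil_iff_mem_primePow {c : ℤ} {m : ℕ} {y : F} (h₁ : N * ((m : ℤ) - 1) < c)
    (h₂ : c ≤ N * m) : y ∈ fil F N c ↔ y ∈ primePow F m := by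
  rw [mem_fil_iff_le_ord h₁ h₂, mem_primePow_iff]

/-- A matrix all of whose entries `M i j` satisfy `k ≤ N * ord (M i j) + j - i`: these matrices
form the `k`-th step of the filtration of the matrix algebra defined by the standard Iwahori
order. -/
def HasDeg (k : ℤ) (M : Matrix (Fin N) (Fin N) F) : Prop :=
  ∀ i j : Fin N, M i j ∈ fil F N (k + (i : ℕ) - (j : ℕ))

theorem HasDeg.mono {k l : ℤ} {M : Matrix (Fin N) (Fin N) F} (h : k ≤ l) (hM : HasDeg l M) :
    HasDeg k M := fun i j => fil_mono (by omega) (hM i j)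

theorem HasDeg.add {k : ℤ} {A B : Matrix (Fin N) (Fin N) F} (hA : HasDeg k A) (hB : HasDeg k B) :
    HasDeg k (A + B) := fun i j => add_mem (hA i j) (hB i j)

theorem HasDeg.neg {k : ℤ} {A : Matrix (Fin N) (Fin N) F} (hA : HasDeg k A) :
    HasDeg k (-A) := fun i j => neg_mem (hA i j)

theorem HasDeg.sub {k : ℤ} {A B : Matrix (Fin N) (Fin N) F} (hA : HasDeg k A) (hB : HasDeg k B) :
    HasDeg k (A - B) := fun i j => sub_mem (hA i j) (hB i j)

theorem HasDeg.mul {k l : ℤ} {A B : Matrix (Fin N) (Fin N) F} (hA : HasDeg k A)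
    (hB : HasDeg l B) : HasDeg (k + l) (A * B) := by
  intro i j
  rw [Matrix.mul_apply]
  refine sum_mem fun m _ => ?_
  have := mul_mem_fil (hA i m) (hB m j)
  exact fil_mono (by omega) this

theorem HasDeg.diagonal {d : Fin N → F} {r : ℤ} (hd : ∀ i, d i = 0 ∨ r ≤ ord (d i)) :
    HasDeg (N * r) (Matrix.diagonal d) := by
  intro i j
  by_cases h : i = j
  · subst h
    rw [Matrix.diagonal_apply_eq]
    exact (hd i).imp id fun h => by
      have : (N : ℤ) * r ≤ N * ord (d i) := mul_le_mul_of_nonneg_left h (by simp)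
      omega
  · rw [Matrix.diagonal_apply_ne _ h]
    exact zero_mem _

theorem hasDeg_one : HasDeg 0 (1 : Matrix (Fin N) (Fin N) F) := by
  rw [← Matrix.diagonal_one]
  simpa using HasDeg.diagonal (F := F) (N := N) (r := 0) (d := fun _ => 1) (by simp)

theorem exists_hasDeg (M : Matrix (Fin N) (Fin N) F) : ∃ m : ℕ, HasDeg (-m) M := by
  obtain ⟨k, hk⟩ := (Set.finite_range fun p : Fin N × Fin N =>
    N * ord (M p.1 p.2) + (p.2 : ℕ) - (p.1 : ℕ)).bddBelow
  refine ⟨k.natAbs, fun i j => Or.inr ?_⟩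
  have := hk ⟨(i, j), rfl⟩
  simp only at this
  omega

theorem mem_iwahoriPlus_iff {g : GL (Fin N) F} :
    g ∈ iwahoriPlus F N ↔ HasDeg 1 (g.val - 1) := by
  constructor
  · rintro ⟨h₁, h₂, h₃⟩ i j
    have hi := i.isLt
    have hj := j.isLt
    rw [Matrix.sub_apply]
    rcases lt_trichotomy i j with h | rfl | h
    · have := Fin.lt_def.mp h
      rw [Matrix.one_apply_ne h.ne, sub_zero, mem_fil_iff_mem_primePow (m := 0)]
      · exact h₂ i j h
      · simp; omega
      · simp; omega
    · rw [Matrix.one_apply_eq, mem_fil_iff_mem_primePow (m := 1)]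
      · exact h₁ i
      · simp
      · simp; omega
    · have := Fin.lt_def.mp h
      rw [Matrix.one_apply_ne h.ne', sub_zero, mem_fil_iff_mem_primePow (m := 1)]
      · exact h₃ i j h
      · simp; omega
      · simp; omega
  · intro H
    refine ⟨fun i => ?_, fun i j h => ?_, fun i j h => ?_⟩
    · have hi := i.isLt
      have := H i i
      rwa [Matrix.sub_apply, Matrix.one_apply_eq, mem_fil_iff_mem_primePow (m := 1) (by simp)
        (by simp; omega)] at this
    · have hj := j.isLt
      have := Fin.lt_def.mp h
      have := H i j
      rwa [Matrix.sub_apply, Matrix.one_apply_ne h.ne, sub_zero,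
        mem_fil_iff_mem_primePow (m := 0) (by simp; omega) (by simp; omega)] at this
    · have hi := i.isLt
      have := Fin.lt_def.mp h
      have := H i j
      rwa [Matrix.sub_apply, Matrix.one_apply_ne h.ne', sub_zero,
        mem_fil_iff_mem_primePow (m := 1) (by simp; omega) (by simp; omega)] at this

theorem HasDeg.of_sub_one {A : Matrix (Fin N) (Fin N) F} (h : HasDeg 1 (A - 1)) : HasDeg 0 A := by
  simpa using (h.mono (k := 0) (by simp)).add hasDeg_one

/-- From `g⁻¹ = 1 - (g - 1) g⁻¹`, any negative degree bound on `g⁻¹` improves by one. Some bound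
always exists, so degree 0 is reached, and one more use gives the claim. -/
theorem HasDeg.inv_sub_one {g : GL (Fin N) F} (h : HasDeg 1 (g.val - 1)) :
    HasDeg 1 ((g⁻¹).val - 1) := by
  have key : (g⁻¹).val = 1 - (g.val - 1) * (g⁻¹).val := by
    rw [sub_mul, Units.mul_inv, one_mul, sub_sub_cancel]
  have step : ∀ m : ℕ, HasDeg (-m) (g⁻¹).val → HasDeg 0 (g⁻¹).val := by
    intro m
    induction m with
    | zero => simp
    | succ m ih =>
      intro hm
      apply ih
      rw [key]
      exact (hasDeg_one.mono (by simp)).sub ((h.mul hm).mono (by simp))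
  obtain ⟨m, hm⟩ := exists_hasDeg (g⁻¹).val
  have h0 := h.mul (step m hm)
  have : (g⁻¹).val - 1 = -((g.val - 1) * (g⁻¹).val) := by
    rw [sub_mul, Units.mul_inv, one_mul, neg_sub]
  rw [this]
  exact h0.neg

/-- The pro-unipotent radical `I⁺` of the Iwahori subgroup, as a subgroup of `GL_N(F)`. -/
def iwahoriPlusSubgroup (F : Type*) [Field F] [ValuativeRel F] [TopologicalSpace F]
    [IsNonarchimedeanLocalField F] (N : ℕ) : Subgroup (GL (Fin N) F) where
  carrier := {g | HasDeg 1 (g.val - 1)}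
  one_mem' := by
    intro i j
    simp [zero_mem]
  mul_mem' := by
    intro g h hg hh
    have : (g * h).val - 1 = (g.val - 1) * h.val + (h.val - 1) := by
      rw [Units.val_mul, sub_mul, one_mul, sub_add_sub_cancel]
    rw [Set.mem_ofPred_eq, this]
    exact ((hg.mul hh.of_sub_one).mono (by simp)).add hh
  inv_mem' := HasDeg.inv_sub_one

theorem mem_iwahoriPlusSubgroup {g : GL (Fin N) F} :
    g ∈ iwahoriPlusSubgroup F N ↔ HasDeg 1 (g.val - 1) := Iff.rfl

/-- Degrees add in `g (u - 1) g⁻¹`. This serves both for powers of `φ` and for torus elements. -/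
theorem conj_mem_iwahoriPlusSubgroup {g u : GL (Fin N) F} {k l : ℤ} (hg : HasDeg k g.val)
    (hg' : HasDeg l (g⁻¹).val) (hkl : 0 ≤ k + l) (hu : u ∈ iwahoriPlusSubgroup F N) :
    g * u * g⁻¹ ∈ iwahoriPlusSubgroup F N := by
  rw [mem_iwahoriPlusSubgroup] at *
  have : (g * u * g⁻¹).val - 1 = g.val * (u.val - 1) * (g⁻¹).val := by
    rw [mul_sub, sub_mul, mul_one, Units.mul_inv, Units.val_mul, Units.val_mul]
  rw [this]
  exact ((hg.mul hu).mul hg').mono (by omega)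

end Degree

/-! ### The anti-involution underlying `θ`. -/

section Tau

variable {F : Type*} [Field F] {N : ℕ}

/-- The anti-involution `M ↦ J ᵗM J⁻¹`, written in terms of entries. -/
def tau (M : Matrix (Fin N) (Fin N) F) : Matrix (Fin N) (Fin N) F :=
  Matrix.of fun i j => (-1) ^ ((i : ℕ) + (j : ℕ)) * M (Fin.rev j) (Fin.rev i)

theorem tau_apply (M : Matrix (Fin N) (Fin N) F) (i j : Fin N) :
    tau M i j = (-1) ^ ((i : ℕ) + (j : ℕ)) * M (Fin.rev j) (Fin.rev i) := rfl

theorem tau_eq (M : Matrix (Fin N) (Fin N) F) :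
    tau M = antiDiagMatrix F N * M.transpose * (antiDiagMatrix F N).transpose := by
  ext i j
  rw [Matrix.mul_apply, Finset.sum_eq_single (Fin.rev j), Matrix.mul_apply,
    Finset.sum_eq_single (Fin.rev i)]
  · simp [antiDiagMatrix, tau_apply, pow_add]
    ring
  · intro b _ hb
    simp [antiDiagMatrix, hb]
  · simp
  · intro b _ hb
    simp [antiDiagMatrix, hb]
  · simp

theorem tau_one : tau (1 : Matrix (Fin N) (Fin N) F) = 1 := by
  rw [tau_eq, Matrix.transpose_one, mul_one, antiDiagMatrix_mul_transpose]

theorem tau_sub (A B : Matrix (Fin N) (Fin N) F) : tau (A - B) = tau A - tau B := by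
  ext i j
  simp [tau_apply, mul_sub]

theorem tau_mul (A B : Matrix (Fin N) (Fin N) F) : tau (A * B) = tau B * tau A := by
  have h : (antiDiagMatrix F N).transpose * antiDiagMatrix F N = 1 :=
    mul_eq_one_comm.mp (antiDiagMatrix_mul_transpose F N)
  simp only [tau_eq, Matrix.transpose_mul]
  calc _ = antiDiagMatrix F N * B.transpose * 1 * A.transpose *
        (antiDiagMatrix F N).transpose := by simp only [mul_one, mul_assoc]
    _ = _ := by
      rw [← h]
      simp only [mul_assoc]

theorem val_theta_inv (g : GL (Fin N) F) : ((theta g)⁻¹).val = tau g.val := by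
  rw [tau_eq, theta, mul_inv_rev, mul_inv_rev, inv_inv, ← mul_assoc]
  rfl

theorem theta_mul (g h : GL (Fin N) F) : theta (g * h) = theta g * theta h := by
  rw [← inv_inj, mul_inv_rev]
  ext1
  rw [Units.val_mul, val_theta_inv, val_theta_inv, val_theta_inv, Units.val_mul, tau_mul]

theorem theta_one : theta (1 : GL (Fin N) F) = 1 := by
  have := theta_mul (1 : GL (Fin N) F) 1
  rwa [one_mul, left_eq_mul] at this

theorem theta_inv (g : GL (Fin N) F) : theta g⁻¹ = (theta g)⁻¹ := by
  rw [eq_inv_iff_mul_eq_one, ← theta_mul, inv_mul_cancel, theta_one]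

theorem theta_zpow (g : GL (Fin N) F) (k : ℤ) : theta (g ^ k) = theta g ^ k :=
  map_zpow (MonoidHom.mk ⟨theta, theta_one⟩ theta_mul) g k

variable [ValuativeRel F] [TopologicalSpace F] [IsNonarchimedeanLocalField F]

theorem HasDeg.tau {k : ℤ} {M : Matrix (Fin N) (Fin N) F} (h : HasDeg k M) :
    HasDeg k (tau M) := by
  intro i j
  have hi := i.isLt
  have hj := j.isLt
  have := h (Fin.rev j) (Fin.rev i)
  rw [Fin.val_rev, Fin.val_rev] at this
  rw [tau_apply]
  have h' := fil_mono (c := k + (i : ℕ) - (j : ℕ)) (by omega) this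
  rcases neg_one_pow_eq_or F ((i : ℕ) + (j : ℕ)) with e | e
  · rwa [e, one_mul]
  · rw [e, neg_one_mul]
    exact neg_mem h'

theorem theta_mem_iwahoriPlusSubgroup {g : GL (Fin N) F} (h : g ∈ iwahoriPlusSubgroup F N) :
    theta g ∈ iwahoriPlusSubgroup F N := by
  rw [← inv_mem_iff, mem_iwahoriPlusSubgroup, val_theta_inv, ← tau_one, ← tau_sub]
  exact HasDeg.tau h

end Tau

/-! ### Powers of `φ` and their degrees. -/

section Phi

variable {F : Type*} [Field F] {N : ℕ}

/-- Symmetry about the anti-diagonal: `tau φ` and `φ` differ only by signs of entries. -/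
theorem cyclicMatrix_rev (c : F) (i j : Fin N) :
    cyclicMatrix N c (Fin.rev j) (Fin.rev i) = cyclicMatrix N c i j := by
  have hi := i.isLt
  have hj := j.isLt
  simp only [cyclicMatrix, Matrix.of_apply, Fin.val_rev]
  congr 1
  · simp; omega
  · congr 1
    simp; omega

theorem cyclicMatrix_mul_apply (c : F) (M : Matrix (Fin N) (Fin N) F) (i j : Fin N) :
    (cyclicMatrix N c * M) i j =
      if h : (i : ℕ) + 1 < N then M ⟨i + 1, h⟩ j else c * M ⟨0, i.pos⟩ j := by
  have hi := i.isLt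
  split_ifs with h
  · rw [Matrix.mul_apply, Finset.sum_eq_single ⟨(i : ℕ) + 1, h⟩]
    · simp [cyclicMatrix]
    · intro b _ hb
      have hb' : ¬ (i : ℕ) + 1 = b := fun e => hb (Fin.ext e.symm)
      simp [cyclicMatrix, hb', h.ne]
    · simp
  · have hN : (i : ℕ) + 1 = N := by omega
    have hN0 : N ≠ 0 := by omega
    rw [Matrix.mul_apply, Finset.sum_eq_single ⟨0, i.pos⟩]
    · simp [cyclicMatrix, hN, hN0]
    · intro b _ hb
      have hb0 : (b : ℕ) ≠ 0 := fun e => hb (Fin.ext e)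
      have hb' : ¬ (i : ℕ) + 1 = b := by have := b.isLt; omega
      simp [cyclicMatrix, hb', hb0]
    · simp

theorem cyclicMatrix_pow_apply (c : F) {k : ℕ} (hk : k ≤ N) (i j : Fin N) :
    (cyclicMatrix N c ^ k) i j =
      if (i : ℕ) + k = j then 1 else if (i : ℕ) + k = j + N then c else 0 := by
  induction k generalizing i with
  | zero =>
    have hi := i.isLt
    have : ¬ (i : ℕ) = j + N := by omega
    simp [Matrix.one_apply, Fin.ext_iff, this]
  | succ k ih =>
    have hi := i.isLt
    have hj := j.isLt
    rw [pow_succ', cyclicMatrix_mul_apply]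
    split_ifs with h₁ h₂ h₃ h₂ h₃ <;> rw [ih (by omega)] <;> simp only
    · rw [if_pos (by omega)]
    · rw [if_neg (by omega), if_pos (by omega)]
    · rw [if_neg (by omega), if_neg (by omega)]
    · omega
    · rw [if_pos (by omega), mul_one]
    · rw [if_neg (by omega), if_neg (by omega), mul_zero]

theorem phi_pow_card (ϖ b : Fˣ) :
    (phi N ϖ b) ^ N = Matrix.GeneralLinearGroup.scalar (Fin N) (ϖ * b) := by
  ext i j
  have hi := i.isLt
  rw [Units.val_pow_eq_pow_val]
  change (cyclicMatrix N ((ϖ * b : Fˣ) : F) ^ N) i j = Matrix.scalar (Fin N) ((ϖ * b : Fˣ) : F) i j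
  rw [cyclicMatrix_pow_apply _ le_rfl, if_neg (by omega)]
  simp [Matrix.diagonal_apply, Fin.ext_iff]

variable [ValuativeRel F] [TopologicalSpace F] [IsNonarchimedeanLocalField F]

theorem hasDeg_cyclicMatrix {c : F} (hc : ord c = 1) : HasDeg 1 (cyclicMatrix N c) := by
  intro i j
  have hi := i.isLt
  simp only [cyclicMatrix, Matrix.of_apply]
  split_ifs with h₁ h₂
  · right
    rw [ord_one]
    omega
  · right
    rw [hc]
    omega
  · exact zero_mem _

theorem hasDeg_cyclicMatrix_transpose {c : F} (hc : ord c = -1) :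
    HasDeg (-1) (cyclicMatrix N c).transpose := by
  intro i j
  have hj := j.isLt
  simp only [cyclicMatrix, Matrix.transpose_apply, Matrix.of_apply]
  split_ifs with h₁ h₂
  · right
    rw [ord_one]
    omega
  · right
    rw [hc]
    omega
  · exact zero_mem _

variable {ϖ b : Fˣ}

theorem hasDeg_phi_zpow (h : ord ((ϖ * b : Fˣ) : F) = 1) (k : ℤ) :
    HasDeg k ((phi N ϖ b) ^ k).val := by
  have h₁ : HasDeg 1 (phi N ϖ b).val := hasDeg_cyclicMatrix h
  have h₂ : HasDeg (-1) ((phi N ϖ b)⁻¹).val := hasDeg_cyclicMatrix_transpose (by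
    rw [Units.val_inv_eq_inv_val, ord_inv, h])
  induction k with
  | zero => simpa using hasDeg_one
  | succ m ih =>
    rw [zpow_add_one, Units.val_mul]
    exact ih.mul h₁
  | pred m ih =>
    rw [zpow_sub_one, Units.val_mul]
    exact ih.mul h₂

theorem phi_zpow_conj_mem (h : ord ((ϖ * b : Fˣ) : F) = 1) (k : ℤ) {u : GL (Fin N) F}
    (hu : u ∈ iwahoriPlusSubgroup F N) :
    (phi N ϖ b) ^ k * u * ((phi N ϖ b) ^ k)⁻¹ ∈ iwahoriPlusSubgroup F N :=
  conj_mem_iwahoriPlusSubgroup (hasDeg_phi_zpow h k)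
    (by rw [← zpow_neg]; exact hasDeg_phi_zpow h (-k)) (by simp) hu

end Phi

/-! ### The affine Bruhat decomposition. -/

section Bruhat

theorem exists_row_ne_zero {F : Type*} [Field F] {N : ℕ} (g : GL (Fin N) F) (i : Fin N) :
    ∃ j, g.val i j ≠ 0 := by
  by_contra! h
  have h₁ : (g.val * (g⁻¹).val) i i = 1 := by rw [Units.mul_inv, Matrix.one_apply_eq]
  rw [Matrix.mul_apply, Finset.sum_eq_zero fun j _ => by rw [h j, zero_mul]] at h₁
  exact zero_ne_one h₁

variable {F : Type*} [Field F] [ValuativeRel F] [TopologicalSpace F]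
  [IsNonarchimedeanLocalField F] {N : ℕ}

/-- The filtration does not jump at an integer `c` that is not divisible by `N`. -/
theorem fil_succ {c : ℤ} (h₁ : -N < c) (h₂ : c < N) (h₀ : c ≠ 0) {y : F} (hy : y ∈ fil F N c) :
    y ∈ fil F N (c + 1) := by
  rcases lt_or_gt_of_ne h₀ with h | h
  · rw [mem_fil_iff_le_ord (e := 0) (by linarith) (by linarith)] at hy ⊢
    exact hy
  · rw [mem_fil_iff_le_ord (e := 1) (by linarith) (by linarith)] at hy ⊢
    exact hy

/-- Off the diagonal `i - j` is not divisible by `N`, so the degree bound 0 improves to 1: modulo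
degree 1, a matrix of degree 0 is diagonal. -/
theorem HasDeg.mem_fil_of_ne {M : Matrix (Fin N) (Fin N) F} (h : HasDeg 0 M) {i j : Fin N}
    (hij : i ≠ j) : M i j ∈ fil F N (1 + (i : ℕ) - (j : ℕ)) := by
  have hi := i.isLt
  have hj := j.isLt
  have hne : (i : ℕ) ≠ j := fun e => hij (Fin.ext e)
  have := fil_succ (by omega) (by omega) (by omega) (h i j)
  exact fil_mono (by omega) this

theorem exists_mem_iwahoriPlusSubgroup_of_sq_zero {A : Matrix (Fin N) (Fin N) F} (hA : HasDeg 1 A)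
    (h : A * A = 0) : ∃ u ∈ iwahoriPlusSubgroup F N, u.val = 1 - A := by
  refine ⟨⟨1 - A, 1 + A, ?_, ?_⟩, ?_, rfl⟩
  · rw [sub_mul, one_mul, mul_add, mul_one, h]
    abel
  · rw [add_mul, one_mul, mul_sub, mul_one, h]
    abel
  · rw [mem_iwahoriPlusSubgroup]
    simpa using hA.neg

/-- Row operations with pivot `(p, q)`. The matrix of multipliers lives in column `p` off the
diagonal, hence has square zero. The hypothesis bounds it only by degree 0; `fil_succ` supplies the
missing unit. -/
theorem exists_clear_column (g : GL (Fin N) F) (p q : Fin N) (hpq : g.val p q ≠ 0)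
    (h : ∀ i : Fin N, g.val i q / g.val p q ∈ fil F N ((i : ℕ) - (p : ℕ))) :
    ∃ u ∈ iwahoriPlusSubgroup F N, ∀ i j : Fin N, (u * g).val i j =
      g.val i j - if i = p then 0 else g.val i q / g.val p q * g.val p j := by
  obtain ⟨u, hu, hu'⟩ := exists_mem_iwahoriPlusSubgroup_of_sq_zero (F := F)
    (A := Matrix.of fun i j : Fin N => if j = p ∧ i ≠ p then g.val i q / g.val p q else 0) (by
      intro i j
      simp only [Matrix.of_apply]
      split_ifs with hij
      · obtain ⟨rfl, hij⟩ := hij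
        have hi := i.isLt
        have hj := j.isLt
        have hne : (i : ℕ) ≠ j := fun e => hij (Fin.ext e)
        have := fil_succ (by omega) (by omega) (by omega) (h i)
        exact fil_mono (by omega) this
      · exact zero_mem _) (by
      ext i j
      rw [Matrix.mul_apply, Matrix.zero_apply]
      refine Finset.sum_eq_zero fun b _ => ?_
      by_cases hb : b = p <;> simp [hb])
  refine ⟨u, hu, fun i j => ?_⟩
  rw [Units.val_mul, hu', sub_mul, one_mul, Matrix.sub_apply, Matrix.mul_apply,
    Finset.sum_eq_single p]
  · by_cases hi : i = p <;> simp [hi]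
  · intro b _ hb
    simp [hb]
  · simp

theorem exists_clear_row (g : GL (Fin N) F) (p q : Fin N) (hpq : g.val p q ≠ 0)
    (h : ∀ j : Fin N, g.val p j / g.val p q ∈ fil F N ((q : ℕ) - (j : ℕ))) :
    ∃ u ∈ iwahoriPlusSubgroup F N, ∀ i j : Fin N, (g * u).val i j =
      g.val i j - if j = q then 0 else g.val i q * (g.val p j / g.val p q) := by
  obtain ⟨u, hu, hu'⟩ := exists_mem_iwahoriPlusSubgroup_of_sq_zero (F := F)
    (A := Matrix.of fun i j : Fin N => if i = q ∧ j ≠ q then g.val p j / g.val p q else 0) (by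
      intro i j
      simp only [Matrix.of_apply]
      split_ifs with hij
      · obtain ⟨rfl, hij⟩ := hij
        have hi := i.isLt
        have hj := j.isLt
        have hne : (j : ℕ) ≠ i := fun e => hij (Fin.ext e)
        have := fil_succ (by omega) (by omega) (by omega) (h j)
        exact fil_mono (by omega) this
      · exact zero_mem _) (by
      ext i j
      rw [Matrix.mul_apply, Matrix.zero_apply]
      refine Finset.sum_eq_zero fun b _ => ?_
      by_cases hb : b = q <;> simp [hb])
  refine ⟨u, hu, fun i j => ?_⟩
  rw [Units.val_mul, hu', mul_sub, mul_one, Matrix.sub_apply, Matrix.mul_apply,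
    Finset.sum_eq_single q]
  · by_cases hi : j = q <;> simp [hi]
  · intro b _ hb
    simp [hb]
  · simp

/-- `M` is monomial on the rows in `S` and the corresponding columns `σ i`. -/
def IsMonomialOn (M : Matrix (Fin N) (Fin N) F) (S : Finset (Fin N)) (σ : Fin N → Fin N) : Prop :=
  ∀ i ∈ S, (∀ j, j ≠ σ i → M i j = 0) ∧ ∀ i', i' ≠ i → M i' (σ i) = 0

theorem div_mem_fil {y z : F} {c : ℤ} (hz : z ≠ 0) (h : y ≠ 0 → c + N * ord z ≤ N * ord y) :
    y / z ∈ fil F N c := by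
  by_cases hy : y = 0
  · simp [hy]
  · right
    rw [div_eq_mul_inv, ord_mul hy (inv_ne_zero hz), ord_inv, mul_add, mul_neg]
    linarith [h hy]

theorem IsMonomialOn.exists_insert {g : GL (Fin N) F} {S : Finset (Fin N)} {σ : Fin N → Fin N}
    (h : IsMonomialOn g.val S σ) (hS : S ≠ Finset.univ) :
    ∃ u ∈ iwahoriPlusSubgroup F N, ∃ v ∈ iwahoriPlusSubgroup F N, ∃ p ∉ S, ∃ τ : Fin N → Fin N,
      IsMonomialOn (u * g * v).val (insert p S) τ := by
  classical
  obtain ⟨i₀, hi₀⟩ : ∃ i, i ∉ S := by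
    by_contra! H
    exact hS (Finset.eq_univ_iff_forall.mpr H)
  obtain ⟨j₀, hj₀⟩ := exists_row_ne_zero g i₀
  -- The pivot is a nonzero entry of least degree among the rows outside `S`; minimality is exactly
  -- what puts the clearing matrices in `I⁺`.
  obtain ⟨⟨p, q⟩, hpq, hmin⟩ := Finset.exists_min_image
    (Finset.univ.filter fun r : Fin N × Fin N => r.1 ∉ S ∧ g.val r.1 r.2 ≠ 0)
    (fun r => (N : ℤ) * ord (g.val r.1 r.2) + (r.2 : ℕ) - (r.1 : ℕ))
    ⟨(i₀, j₀), by simp [hi₀, hj₀]⟩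
  simp only [Finset.mem_filter, Finset.mem_univ, true_and, Prod.forall] at hpq hmin
  obtain ⟨hp, hpq⟩ := hpq
  have hne : ∀ i ∈ S, i ≠ p := fun i hi e => hp (e ▸ hi)
  have hq : ∀ i ∈ S, q ≠ σ i := fun i hi e => hpq (by rw [e, (h i hi).2 p (hne i hi).symm])
  obtain ⟨u, hu, huM⟩ := exists_clear_column g p q hpq fun i =>
    div_mem_fil hpq fun hi => by
      have := hmin i q ⟨fun hiS => hi ((h i hiS).1 q (hq i hiS)), hi⟩
      omega
  have hup : ∀ j, (u * g).val p j = g.val p j := fun j => by rw [huM, if_pos rfl, sub_zero]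
  have hq0 : ∀ i, i ≠ p → (u * g).val i q = 0 := fun i hi => by
    rw [huM, if_neg hi, div_mul_cancel₀ _ hpq, sub_self]
  obtain ⟨v, hv, hvM⟩ := exists_clear_row (u * g) p q (by rwa [hup]) fun j => by
    rw [hup, hup]
    refine div_mem_fil hpq fun hj => ?_
    have := hmin p j ⟨hp, hj⟩
    omega
  refine ⟨u, hu, v, hv, p, hp, Function.update σ p q, fun i hi => ?_⟩
  rcases Finset.mem_insert.mp hi with rfl | hiS
  · rw [Function.update_self]
    refine ⟨fun j hj => ?_, fun i' hi' => ?_⟩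
    · rw [hvM, if_neg hj, mul_div_cancel₀ _ (by rwa [hup]), sub_self]
    · rw [hvM, if_pos rfl, sub_zero, hq0 i' hi']
  -- Rows and columns already treated survive: row `i` vanishes in column `q` and column `σ i`
  -- vanishes in row `p`, so every correction term there is zero.
  · rw [Function.update_of_ne (hne i hiS)]
    refine ⟨fun j hj => ?_, fun i' hi' => ?_⟩
    · rw [hvM, hq0 i (hne i hiS), huM, if_neg (hne i hiS), (h i hiS).1 j hj,
        (h i hiS).1 q (hq i hiS)]
      simp
    · rw [hvM, hup, huM, (h i hiS).2 i' hi', (h i hiS).2 p (hne i hiS).symm]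
      simp

/-- The affine Bruhat decomposition: every element of `GL_N(F)` is a monomial matrix up to
multiplication by `I⁺` on both sides. -/
theorem exists_monomial (g : GL (Fin N) F) :
    ∃ u ∈ iwahoriPlusSubgroup F N, ∃ v ∈ iwahoriPlusSubgroup F N, ∃ σ : Equiv.Perm (Fin N),
      ∀ i j, j ≠ σ i → (u * g * v).val i j = 0 := by
  classical
  have key : ∀ k ≤ N, ∃ u ∈ iwahoriPlusSubgroup F N, ∃ v ∈ iwahoriPlusSubgroup F N,
      ∃ S : Finset (Fin N), ∃ σ : Fin N → Fin N, S.card = k ∧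
        IsMonomialOn (u * g * v).val S σ := by
    intro k
    induction k with
    | zero =>
      exact fun _ => ⟨1, one_mem _, 1, one_mem _, ∅, id, rfl, fun i hi => by simp at hi⟩
    | succ k ih =>
      intro hk
      obtain ⟨u, hu, v, hv, S, σ, hS, h⟩ := ih (by omega)
      obtain ⟨u', hu', v', hv', p, hp, τ, h'⟩ := h.exists_insert (by
        rintro rfl
        rw [Finset.card_univ, Fintype.card_fin] at hS
        omega)
      refine ⟨u' * u, mul_mem hu' hu, v * v', mul_mem hv hv', insert p S, τ, ?_, ?_⟩
      · rw [Finset.card_insert_of_notMem hp, hS]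
      · simpa only [mul_assoc] using h'
  obtain ⟨u, hu, v, hv, S, σ, hS, h⟩ := key N le_rfl
  obtain rfl : S = Finset.univ := by
    rw [← Finset.card_eq_iff_eq_univ, hS, Fintype.card_fin]
  have hσ : Function.Injective σ := by
    intro i j hij
    by_contra hne
    obtain ⟨l, hl⟩ := exists_row_ne_zero (u * g * v) i
    by_cases hl' : l = σ i
    · exact hl (by rw [hl', hij]; exact (h j (Finset.mem_univ j)).2 i hne)
    · exact hl ((h i (Finset.mem_univ i)).1 l hl')
  exact ⟨u, hu, v, hv, Equiv.ofBijective σ (Finite.injective_iff_bijective.mp hσ),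
    fun i j hj => (h i (Finset.mem_univ i)).1 j hj⟩

end Bruhat

/-! ### Consequences of residue characteristic 2. -/

section Dyadic

variable {F : Type*} [Field F] [ValuativeRel F] [TopologicalSpace F]
  [IsNonarchimedeanLocalField F] {N : ℕ}

/-- The ultrametric principle that a strictly smaller perturbation does not change the order. The
case `y - z = 0` is separate because `ord 0 = 0`. -/
theorem ne_zero_and_ord_eq {y z : F} (hz : z ≠ 0) (h : y - z = 0 ∨ ord z < ord (y - z)) :
    y ≠ 0 ∧ ord y = ord z := by
  by_cases hyz : y - z = 0
  · rw [sub_eq_zero.mp hyz]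
    exact ⟨hz, rfl⟩
  replace h := h.resolve_left hyz
  have hy : y ≠ 0 := by
    rintro rfl
    simp at h
  refine ⟨hy, le_antisymm ?_ ?_⟩
  · by_contra! hlt
    have := le_ord_add (c := ord z + 1) hy (y := y) (z := -(y - z)) (neg_ne_zero.mpr hyz)
      (by simpa using hz) (by omega) (by rw [ord_neg]; omega)
    rw [neg_sub, add_sub_cancel] at this
    omega
  · have := le_ord_add (c := ord z) hyz hz (by simpa using hy) h.le le_rfl
    simpa using this

theorem iwahoriPlusSubgroup_diag {u : GL (Fin N) F} (hu : u ∈ iwahoriPlusSubgroup F N)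
    (i : Fin N) : u.val i i ≠ 0 ∧ ord (u.val i i) = 0 := by
  have h := (mem_iwahoriPlus_iff.mpr hu).1 i
  rw [mem_primePow_iff] at h
  rw [← ord_one (F := F)]
  refine ne_zero_and_ord_eq one_ne_zero (h.imp id fun h => ?_)
  rw [ord_one]
  exact_mod_cast h

variable [CharP 𝓀[F] 2]

theorem two_mem_primePow : (2 : F) ∈ primePow F 1 := by
  refine ⟨2, ?_, rfl⟩
  rw [pow_one, SetLike.mem_coe, ← IsLocalRing.residue_eq_zero_iff, map_ofNat]
  exact_mod_cast CharP.cast_eq_zero 𝓀[F] 2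

theorem two_mem_fil : (2 : F) ∈ fil F N N :=
  (mem_primePow_iff.mp two_mem_primePow).imp id fun h => by
    have : (N : ℤ) * 1 ≤ N * ord (2 : F) :=
      mul_le_mul_of_nonneg_left (by exact_mod_cast h) (by simp)
    omega

/-- Each entry of the difference is 0 or -2 times an entry of `φ`, and the factor 2 raises the
degree by at least `N ≥ 1`. -/
theorem hasDeg_tau_phi_sub_phi {ϖ b : Fˣ} (h : ord ((ϖ * b : Fˣ) : F) = 1) :
    HasDeg 2 (tau (phi N ϖ b).val - (phi N ϖ b).val) := by
  intro i j
  have hi := i.isLt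
  have h₁ : HasDeg 1 (phi N ϖ b).val := hasDeg_cyclicMatrix h
  have h₂ := h₁ i j
  have h₃ := fil_mono (c := 2 + (i : ℕ) - (j : ℕ)) (by omega)
    (mul_mem_fil (two_mem_fil (F := F) (N := N)) h₂)
  have h₄ : (phi N ϖ b).val (Fin.rev j) (Fin.rev i) = (phi N ϖ b).val i j :=
    cyclicMatrix_rev _ i j
  rw [Matrix.sub_apply, tau_apply, h₄]
  rcases neg_one_pow_eq_or F ((i : ℕ) + (j : ℕ)) with e | e
  · rw [e, one_mul, sub_self]
    exact zero_mem _
  · rw [e, show (-1 : F) * (phi N ϖ b).val i j - (phi N ϖ b).val i j =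
      -(2 * (phi N ϖ b).val i j) by ring]
    exact neg_mem h₃

theorem theta_phi_inv_mul_mem {ϖ b : Fˣ} (h : ord ((ϖ * b : Fˣ) : F) = 1) :
    (theta (phi N ϖ b))⁻¹ * (phi N ϖ b)⁻¹ ∈ iwahoriPlusSubgroup F N := by
  rw [mem_iwahoriPlusSubgroup, Units.val_mul, val_theta_inv,
    ← Units.mul_inv (phi N ϖ b), ← sub_mul]
  have h₂ : HasDeg (-1) ((phi N ϖ b)⁻¹).val := by
    simpa using hasDeg_phi_zpow (N := N) h (-1)
  exact (hasDeg_tau_phi_sub_phi h).mul h₂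

/-- If `ψ` and `f` agree modulo a subgroup stable under conjugation by powers of `f`, so do their
powers. Applied to `ψ = θ(φ)⁻¹` and `f = φ`. -/
theorem _root_.Subgroup.zpow_mul_zpow_inv_mem {G : Type*} [Group G] {K : Subgroup G} {f ψ : G}
    (hK : ∀ (k : ℤ), ∀ u ∈ K, f ^ k * u * (f ^ k)⁻¹ ∈ K) (h : ψ * f⁻¹ ∈ K) (k : ℤ) :
    ψ ^ k * (f ^ k)⁻¹ ∈ K := by
  induction k with
  | zero => simp
  | succ m ih =>
    convert mul_mem ih (hK m _ h) using 1
    simp only [zpow_add_one]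
    group
  | pred m ih =>
    have h' := hK (-1) _ (inv_mem h)
    convert mul_mem ih (hK (-m) _ h') using 1
    simp only [zpow_sub_one]
    group

theorem theta_phi_zpow_mem {ϖ b : Fˣ} (h : ord ((ϖ * b : Fˣ) : F) = 1) (k : ℤ) :
    (theta (phi N ϖ b ^ k))⁻¹ * (phi N ϖ b ^ k)⁻¹ ∈ iwahoriPlusSubgroup F N := by
  rw [theta_zpow, ← inv_zpow]
  exact Subgroup.zpow_mul_zpow_inv_mem (fun k u hu => phi_zpow_conj_mem h k hu)
    (theta_phi_inv_mul_mem h) k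

end Dyadic

/-! ### Genericity under twisted conjugation by `I⁺`. -/

section Generic

variable {F : Type*} [Field F] [ValuativeRel F] [TopologicalSpace F]
  [IsNonarchimedeanLocalField F] {N n : ℕ}

/-- Expand `(1 + A)(1 + B)(1 + tau A)` with `A = h - 1` and `B = x - 1`: beyond the linear terms
every product has degree at least 2. -/
theorem hasDeg_twisted_conj {h x : GL (Fin N) F} (hh : h ∈ iwahoriPlusSubgroup F N)
    (hx : x ∈ iwahoriPlusSubgroup F N) :
    HasDeg 2 ((h * x * (theta h)⁻¹).val - x.val - (h.val - 1) - tau (h.val - 1)) := by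
  have e : (h * x * (theta h)⁻¹).val - x.val - (h.val - 1) - tau (h.val - 1) =
      (h.val - 1) * (x.val - 1) + (h.val - 1) * tau (h.val - 1) +
        (x.val - 1) * tau (h.val - 1) + (h.val - 1) * (x.val - 1) * tau (h.val - 1) := by
    rw [Units.val_mul, Units.val_mul, val_theta_inv, tau_sub, tau_one]
    noncomm_ring
  have hτ : HasDeg 1 (tau (h.val - 1)) := HasDeg.tau hh
  rw [e]
  exact (((hh.mul hx).add (hh.mul hτ)).add (hx.mul hτ)).add
    (((hh.mul hx).mul hτ).mono (by simp))

theorem IsThetaAffineGeneric.twisted_conj [CharP 𝓀[F] 2] {x h : GL (Fin (2 * n + 1)) F}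
    (hx : IsThetaAffineGeneric n x) (hh : h ∈ iwahoriPlusSubgroup F (2 * n + 1)) :
    IsThetaAffineGeneric n (h * x * (theta h)⁻¹) := by
  obtain ⟨hx₁, hx₂, hx₃⟩ := hx
  have hx₁' := mem_iwahoriPlus_iff.mp hx₁
  have hd := hasDeg_twisted_conj hh hx₁'
  refine ⟨mem_iwahoriPlus_iff.mpr
    (mul_mem (mul_mem hh hx₁') (inv_mem (theta_mem_iwahoriPlusSubgroup hh))), fun i => ?_, ?_⟩
  · have hi := i.isLt
    have e₁ := hd ⟨i, by omega⟩ ⟨i + 1, by omega⟩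
    have e₂ := hd ⟨2 * n - 1 - i, by omega⟩ ⟨2 * n - i, by omega⟩
    have r₁ : Fin.rev (⟨i, by omega⟩ : Fin (2 * n + 1)) = ⟨2 * n - i, by omega⟩ := by
      ext; simp [Fin.val_rev]
    have r₂ : Fin.rev (⟨i + 1, by omega⟩ : Fin (2 * n + 1)) = ⟨2 * n - 1 - i, by omega⟩ := by
      ext; simp [Fin.val_rev]; omega
    have r₃ := (Fin.rev_eq_iff.mp r₁.symm.symm).symm
    have r₄ := (Fin.rev_eq_iff.mp r₂.symm.symm).symm
    simp only [Matrix.sub_apply, tau_apply, r₁, r₂, r₃, r₄] at e₁ e₂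
    -- On the superdiagonal `tau` exchanges the two mirror positions with sign -1, so the linear
    -- terms `A + tau A` cancel in their sum.
    rw [Odd.neg_one_pow ⟨i, by omega⟩] at e₁
    rw [Odd.neg_one_pow ⟨2 * n - 1 - i, by omega⟩] at e₂
    have := add_mem (fil_mono (c := 1) (by push_cast; omega) e₁)
      (fil_mono (c := 1) (by omega) e₂)
    rw [mem_fil_iff_le_ord (e := 1) (by simp) (by simp)] at this
    obtain ⟨h0, h1⟩ := mem_integerUnits_iff.mp (hx₂ i)
    rw [mem_integerUnits_iff, ← h1]
    refine ne_zero_and_ord_eq h0 ?_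
    rw [h1, Int.lt_iff_add_one_le, zero_add]
    convert this using 2 <;> ring_nf
  · have e₁ := hd (Fin.last (2 * n)) 0
    rw [Set.mem_sdiff, mem_primePow_iff, mem_primePow_iff] at hx₃ ⊢
    push Not at hx₃
    obtain ⟨h1, h0, h2⟩ := hx₃
    replace h1 := h1.resolve_left h0
    have hα := hh (Fin.last (2 * n)) 0
    -- The corner is fixed by the reflection with sign +1, so the linear terms contribute `2 α`,
    -- which lies in `𝔭²` because `2` and `α` lie in `𝔭`.
    have h2α := fil_mono (c := 2 + ((Fin.last (2 * n) : Fin (2 * n + 1)) : ℕ) -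
      ((0 : Fin (2 * n + 1)) : ℕ)) (by simp; omega) (mul_mem_fil (two_mem_fil (F := F)) hα)
    have e₂ := add_mem e₁ h2α
    simp only [Matrix.sub_apply, tau_apply, Fin.rev_last, Fin.rev_zero] at e₂
    rw [Even.neg_one_pow (by simp)] at e₂
    rw [mem_fil_iff_le_ord (e := 2) (by simp; omega) (by simp; omega)] at e₂
    have := ne_zero_and_ord_eq (y := (h * x * (theta h)⁻¹).val (Fin.last (2 * n)) 0) h0
      (by
        have e : ord (x.val (Fin.last (2 * n)) 0) = 1 := by push_cast at h1 h2; omega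
        rw [e, Int.lt_iff_add_one_le]
        convert e₂ using 2 <;> ring_nf)
    rw [this.2]
    push Not
    exact ⟨Or.inr h1, this.1, h2⟩

theorem IsThetaAffineGeneric.superdiag {x : GL (Fin (2 * n + 1)) F}
    (hx : IsThetaAffineGeneric n x) (a : Fin (2 * n)) :
    (x.val a.castSucc a.succ ≠ 0 ∧ ord (x.val a.castSucc a.succ) = 0) ∨
      (x.val a.succ.rev a.castSucc.rev ≠ 0 ∧ ord (x.val a.succ.rev a.castSucc.rev) = 0) := by
  have ha := a.isLt
  -- Here `fil F 1 1` is just `𝔭`; two non-units could not add up to a unit.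
  have hnonunit : ∀ i j, i < j → x.val i j ∉ integerUnits F → x.val i j ∈ fil F 1 1 := by
    intro i j hij hu
    rw [mem_integerUnits_iff] at hu
    push Not at hu
    have h₁ := hx.1.2.1 i j hij
    rw [mem_primePow_iff] at h₁
    by_cases h0 : x.val i j = 0
    · exact Or.inl h0
    · have := h₁.resolve_left h0
      have := hu h0
      right
      push_cast at *
      omega
  have hsum : x.val a.castSucc a.succ + x.val a.succ.rev a.castSucc.rev ∈ integerUnits F := by
    by_cases h : (a : ℕ) < n
    · convert hx.2.1 ⟨a, h⟩ using 3 <;> ext <;> simp [Fin.val_rev] <;> omega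
    · rw [add_comm]
      convert hx.2.1 ⟨2 * n - 1 - a, by omega⟩ using 3 <;> ext <;> simp [Fin.val_rev] <;> omega
  rw [← mem_integerUnits_iff, ← mem_integerUnits_iff]
  by_contra! H
  have := add_mem (hnonunit _ _ (Fin.castSucc_lt_succ) H.1)
    (hnonunit _ _ (Fin.rev_lt_rev.mpr Fin.castSucc_lt_succ) H.2)
  obtain ⟨h0, h1⟩ := mem_integerUnits_iff.mp hsum
  rw [mem_fil, h1] at this
  simp [h0] at this

theorem IsThetaAffineGeneric.corner {x : GL (Fin (2 * n + 1)) F}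
    (hx : IsThetaAffineGeneric n x) :
    x.val (Fin.last (2 * n)) 0 ≠ 0 ∧ ord (x.val (Fin.last (2 * n)) 0) = 1 := by
  have h := hx.2.2
  rw [Set.mem_sdiff, mem_primePow_iff, mem_primePow_iff] at h
  push Not at h
  obtain ⟨h1, h0, h2⟩ := h
  replace h1 := h1.resolve_left h0
  push_cast at h1 h2
  exact ⟨h0, by omega⟩

end Generic

/-! ### Column degrees of a monomial matrix. -/

section Monomial

variable {F : Type*} [Field F] {N n : ℕ}

theorem monomial_mul_apply {M : Matrix (Fin N) (Fin N) F} {σ : Equiv.Perm (Fin N)}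
    (hM : ∀ i j, j ≠ σ i → M i j = 0) (X : Matrix (Fin N) (Fin N) F) (i j : Fin N) :
    (M * X) i j = M i (σ i) * X (σ i) j := by
  rw [Matrix.mul_apply, Finset.sum_eq_single (σ i)]
  · intro b _ hb
    rw [hM i b hb, zero_mul]
  · simp

theorem mul_monomial_apply {M : Matrix (Fin N) (Fin N) F} {σ : Equiv.Perm (Fin N)}
    (hM : ∀ i j, j ≠ σ i → M i j = 0) (X : Matrix (Fin N) (Fin N) F) (i j : Fin N) :
    (X * M) i (σ j) = X i j * M j (σ j) := by
  rw [Matrix.mul_apply, Finset.sum_eq_single j]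
  · intro b _ hb
    rw [hM b (σ j) (fun e => hb (σ.injective e).symm), mul_zero]
  · simp

theorem tau_monomial_mul_apply {M : Matrix (Fin N) (Fin N) F} {σ : Equiv.Perm (Fin N)}
    (hM : ∀ i j, j ≠ σ i → M i j = 0) (X : Matrix (Fin N) (Fin N) F) (i j : Fin N) :
    (tau M * X) (Fin.rev (σ i)) j =
      (-1) ^ ((Fin.rev (σ i) : ℕ) + (Fin.rev i : ℕ)) * M i (σ i) * X (Fin.rev i) j := by
  rw [Matrix.mul_apply, Finset.sum_eq_single (Fin.rev i)]
  · rw [tau_apply, Fin.rev_rev, Fin.rev_rev]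
  · intro b _ hb
    rw [tau_apply, Fin.rev_rev, hM, mul_zero, zero_mul]
    exact fun e => hb (by rw [σ.injective e, Fin.rev_rev])
  · simp

theorem mul_tau_monomial_apply {M : Matrix (Fin N) (Fin N) F} {σ : Equiv.Perm (Fin N)}
    (hM : ∀ i j, j ≠ σ i → M i j = 0) (X : Matrix (Fin N) (Fin N) F) (i j : Fin N) :
    (X * tau M) i (Fin.rev j) =
      X i (Fin.rev (σ j)) * ((-1) ^ ((Fin.rev (σ j) : ℕ) + (Fin.rev j : ℕ)) * M j (σ j)) := by
  rw [Matrix.mul_apply, Finset.sum_eq_single (Fin.rev (σ j))]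
  · rw [tau_apply, Fin.rev_rev, Fin.rev_rev]
  · intro b _ hb
    rw [tau_apply, Fin.rev_rev, hM, mul_zero, mul_zero]
    exact fun e => hb (by rw [← e, Fin.rev_rev])
  · simp

theorem monomial_ne_zero {m : GL (Fin N) F} {σ : Equiv.Perm (Fin N)}
    (hm : ∀ i j, j ≠ σ i → m.val i j = 0) (i : Fin N) : m.val i (σ i) ≠ 0 := by
  obtain ⟨j, hj⟩ := exists_row_ne_zero m i
  have : j = σ i := by
    by_contra h
    exact hj (hm i j h)
  rwa [← this]

theorem scalar_mul_comm (c : Fˣ) (g : GL (Fin N) F) :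
    Matrix.GeneralLinearGroup.scalar (Fin N) c * g =
      g * Matrix.GeneralLinearGroup.scalar (Fin N) c := by
  ext i j
  simp [mul_comm]

variable [ValuativeRel F] [TopologicalSpace F] [IsNonarchimedeanLocalField F]

theorem ord_neg_one_pow_mul (k : ℕ) (y : F) : ord ((-1) ^ k * y) = ord y := by
  rcases neg_one_pow_eq_or F k with e | e <;> simp [e]

/-- The degree of the nonzero entry of a monomial matrix in column `a`. -/
noncomputable def colDeg (M : Matrix (Fin N) (Fin N) F) (σ : Equiv.Perm (Fin N)) (a : Fin N) : ℤ :=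
  N * ord (M (σ.symm a) a) + (a : ℕ) - (σ.symm a : ℕ)

theorem colDeg_apply (M : Matrix (Fin N) (Fin N) F) (σ : Equiv.Perm (Fin N)) (i : Fin N) :
    colDeg M σ (σ i) = N * ord (M i (σ i)) + (σ i : ℕ) - (i : ℕ) := by
  rw [colDeg, Equiv.symm_apply_apply]

/-- Each entry of `m * x * tau m` is a single product, and its degree is the sum of the degrees of
the three factors. -/
theorem le_colDeg_add_colDeg {m x : GL (Fin N) F} {σ : Equiv.Perm (Fin N)}
    (hm : ∀ i j, j ≠ σ i → m.val i j = 0) {K : ℤ} (h : HasDeg K (m * x * (theta m)⁻¹).val)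
    (a b : Fin N) (hab : x.val a b ≠ 0) :
    K ≤ colDeg m.val σ a + colDeg m.val σ (Fin.rev b) + N * ord (x.val a b) +
      (b : ℕ) - (a : ℕ) := by
  obtain ⟨i, rfl⟩ := σ.surjective a
  obtain ⟨l, hl⟩ := σ.surjective (Fin.rev b)
  obtain rfl : b = Fin.rev (σ l) := by rw [hl, Fin.rev_rev]
  have hi := monomial_ne_zero hm i
  have hl := monomial_ne_zero hm l
  have hs : ((-1 : F) ^ ((Fin.rev (σ l) : ℕ) + (Fin.rev l : ℕ))) ≠ 0 := by simp
  have H := h i (Fin.rev l)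
  rw [Units.val_mul, Units.val_mul, val_theta_inv, mul_tau_monomial_apply hm,
    monomial_mul_apply hm, mem_fil] at H
  replace H := H.resolve_left (by simp [hi, hl, hab])
  rw [ord_mul (mul_ne_zero hi hab) (mul_ne_zero hs hl), ord_mul hi hab, ord_neg_one_pow_mul] at H
  rw [Fin.rev_rev, colDeg_apply, colDeg_apply]
  simp only [Fin.val_rev] at H ⊢
  have := l.isLt
  have := (σ l).isLt
  simp only [mul_add] at H
  omega

/-- Write `x⁻¹ = tau m * y⁻¹ * m` with `y = m * x * (theta m)⁻¹`. A diagonal entry of `x⁻¹` has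
degree 0 and is a single product, whose middle factor has degree at least `-K`. -/
theorem colDeg_add_colDeg_rev_le {m x : GL (Fin N) F} {σ : Equiv.Perm (Fin N)}
    (hm : ∀ i j, j ≠ σ i → m.val i j = 0) {K : ℤ}
    (h : HasDeg (-K) ((m * x * (theta m)⁻¹)⁻¹).val)
    (hx : ∀ i, (x⁻¹).val i i ≠ 0 ∧ ord ((x⁻¹).val i i) = 0) (a : Fin N) :
    colDeg m.val σ a + colDeg m.val σ (Fin.rev a) ≤ K := by
  obtain ⟨i, rfl⟩ := σ.surjective a
  obtain ⟨l, hl⟩ := σ.surjective (Fin.rev (σ i))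
  have hi := monomial_ne_zero hm i
  have hl' := monomial_ne_zero hm l
  have hs : ((-1 : F) ^ ((Fin.rev (σ l) : ℕ) + (Fin.rev l : ℕ))) ≠ 0 := by simp
  have e : (x⁻¹).val = tau m.val * ((m * x * (theta m)⁻¹)⁻¹).val * m.val := by
    rw [← val_theta_inv, ← Units.val_mul, ← Units.val_mul]
    congr 1
    group
  obtain ⟨h0, h1⟩ := hx (σ i)
  have hrev : σ i = Fin.rev (σ l) := by rw [hl, Fin.rev_rev]
  have e' : (x⁻¹).val (σ i) (σ i) = (-1) ^ ((Fin.rev (σ l) : ℕ) + (Fin.rev l : ℕ)) *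
      m.val l (σ l) * ((m * x * (theta m)⁻¹)⁻¹).val (Fin.rev l) i * m.val i (σ i) := by
    rw [e, mul_monomial_apply hm]
    congr 1
    conv_lhs => rw [hrev]
    rw [tau_monomial_mul_apply hm]
  rw [e'] at h0 h1
  have hy : ((m * x * (theta m)⁻¹)⁻¹).val (Fin.rev l) i ≠ 0 := by
    intro h
    rw [h, mul_zero, zero_mul] at h0
    exact h0 rfl
  have H := (h (Fin.rev l) i).resolve_left hy
  rw [ord_mul (mul_ne_zero (mul_ne_zero hs hl') hy) hi, ord_mul (mul_ne_zero hs hl') hy,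
    ord_neg_one_pow_mul] at h1
  have h2 := congrArg (fun t : ℤ => (N : ℤ) * t) h1
  simp only [mul_add, mul_zero] at h2
  rw [← hl, colDeg_apply, colDeg_apply]
  have hv := congrArg Fin.val hl
  simp only [Fin.val_rev] at H hv
  have := l.isLt
  have := (σ i).isLt
  omega

/-- Modulo `N`, the value at `a` is the row index `σ.symm a`. -/
theorem sub_colDeg_injective (M : Matrix (Fin N) (Fin N) F) (σ : Equiv.Perm (Fin N)) :
    Function.Injective fun a : Fin N => ((a : ℕ) : ℤ) - colDeg M σ a := by
  intro a b hab
  obtain ⟨i, rfl⟩ := σ.surjective a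
  obtain ⟨j, rfl⟩ := σ.surjective b
  simp only [colDeg_apply] at hab
  have hi := i.isLt
  have hj := j.isLt
  have h1 : ((i : ℕ) : ℤ) = j + N * (ord (M i (σ i)) - ord (M j (σ j))) := by
    rw [mul_sub]
    omega
  have h2 := congrArg (· % (N : ℤ)) h1
  simp only [Int.add_mul_emod_self_left] at h2
  rw [Int.emod_eq_of_lt (by omega) (by omega), Int.emod_eq_of_lt (by omega) (by omega)] at h2
  rw [Fin.ext (by exact_mod_cast h2 : (i : ℕ) = j)]

/-- The fixed middle index gives `K = 2L`. By parity the last hypothesis says that the least value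
of `C` is at least `L`, and values paired to sum `2L` must then all equal `L`. -/
theorem eq_const_of_antitone_of_rev {C : Fin (2 * n + 1) → ℤ} {K : ℤ}
    (hC : Antitone C) (hsym : ∀ a, C a + C (Fin.rev a) = K)
    (hlast : K ≤ 2 * C (Fin.last (2 * n)) + 1) :
    ∃ L, K = 2 * L ∧ ∀ a, C a = L := by
  have hc : Fin.rev (⟨n, by omega⟩ : Fin (2 * n + 1)) = ⟨n, by omega⟩ := by
    ext
    simp [Fin.val_rev]
    omega
  have h1 := hsym ⟨n, by omega⟩
  rw [hc] at h1
  refine ⟨C ⟨n, by omega⟩, by omega, fun a => ?_⟩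
  have h2 := hsym a
  have h3 := hC (Fin.le_last a)
  have h4 := hC (Fin.le_last (Fin.rev a))
  have h5 := hC (Fin.le_last (⟨n, by omega⟩ : Fin (2 * n + 1)))
  omega

/-- A monomial matrix that carries a generic element to an element of constant degree has itself
constant degree. -/
theorem exists_hasDeg_of_generic {m x : GL (Fin (2 * n + 1)) F}
    {σ : Equiv.Perm (Fin (2 * n + 1))} (hm : ∀ i j, j ≠ σ i → m.val i j = 0) {K : ℤ}
    (hx : IsThetaAffineGeneric n x) (h : HasDeg K (m * x * (theta m)⁻¹).val)
    (h' : HasDeg (-K) ((m * x * (theta m)⁻¹)⁻¹).val) :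
    ∃ L, K = 2 * L ∧ HasDeg L m.val := by
  have hx' : x ∈ iwahoriPlusSubgroup F (2 * n + 1) := mem_iwahoriPlus_iff.mp hx.1
  have hle := le_colDeg_add_colDeg hm h
  have hge := colDeg_add_colDeg_rev_le hm h' (iwahoriPlusSubgroup_diag (inv_mem hx'))
  have hinj := sub_colDeg_injective m.val σ
  obtain ⟨C, hCdef⟩ : ∃ C, C = colDeg m.val σ := ⟨_, rfl⟩
  rw [← hCdef] at hle hge hinj
  have hsym : ∀ a, C a + C (Fin.rev a) = K := by
    intro a
    refine le_antisymm (hge a) ?_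
    obtain ⟨h0, h1⟩ := iwahoriPlusSubgroup_diag hx' a
    have := hle a a h0
    rw [h1] at this
    omega
  have hanti : Antitone C := by
    rw [Fin.antitone_iff_succ_le]
    intro a
    -- The superdiagonal unit only gives `C a.succ ≤ C a.castSucc + 1`; injectivity of `a - C a`
    -- removes equality.
    have hne : C a.succ ≠ C a.castSucc + 1 := by
      intro e
      have : a.castSucc = a.succ := hinj (by
        simp only [e, Fin.val_castSucc, Fin.val_succ]
        push_cast
        ring)
      exact absurd this Fin.castSucc_lt_succ.ne
    have hs := hsym a.succ
    have ha := a.isLt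
    rcases hx.superdiag a with ⟨h0, h1⟩ | ⟨h0, h1⟩
    · have := hle _ _ h0
      rw [h1, Fin.val_castSucc, Fin.val_succ] at this
      push_cast at this
      omega
    · have := hle _ _ h0
      rw [h1, Fin.rev_rev] at this
      simp only [Fin.val_rev, Fin.val_castSucc, Fin.val_succ] at this
      omega
  obtain ⟨L, hL, hCL⟩ := eq_const_of_antitone_of_rev hanti hsym (by
    obtain ⟨h0, h1⟩ := hx.corner
    have := hle _ _ h0
    rw [h1, Fin.rev_zero, Fin.val_last, Fin.val_zero] at this
    push_cast at this
    omega)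
  refine ⟨L, hL, fun i j => ?_⟩
  by_cases hj : j = σ i
  · subst hj
    right
    have := hCL (σ i)
    rw [hCdef, colDeg_apply] at this
    omega
  · rw [hm i j hj]
    exact zero_mem _

end Monomial

/-! ### Extracting the torus factor in degree zero. -/

section Torus

variable {F : Type*} [Field F] [ValuativeRel F] [TopologicalSpace F]
  [IsNonarchimedeanLocalField F] {N n : ℕ}

theorem HasDeg.mul_diag_sub_mem {A B : Matrix (Fin N) (Fin N) F} (hA : HasDeg 0 A)
    (hB : HasDeg 0 B) (i : Fin N) : (A * B) i i - A i i * B i i ∈ fil F N 1 := by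
  rw [Matrix.mul_apply, ← Finset.add_sum_erase _ _ (Finset.mem_univ i), add_sub_cancel_left]
  refine sum_mem fun j hj => ?_
  have := mul_mem_fil (hA.mem_fil_of_ne (Finset.ne_of_mem_erase hj).symm) (hB j i)
  exact fil_mono (by omega) this

theorem mul_mem_fil_of_ord {y z : F} {c : ℤ} (hy : ord y = 0) (hz : z ∈ fil F N c) :
    y * z ∈ fil F N c := by
  have : y ∈ fil F N 0 := Or.inr (by simp [hy])
  simpa using mul_mem_fil this hz

/-- An element of the Iwahori order whose diagonal is congruent, up to the scalar `ζ`, to a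
`θ`-fixed one, decomposes as a scalar times an element of `I⁺` times an element of `T^θ(q)`. -/
theorem exists_thetaTorus_of_diag {D : GL (Fin (2 * n + 1)) F} (hD : HasDeg 0 D.val) {ζ : F}
    (hζ0 : ζ ≠ 0) (hζ : ord ζ = 0)
    (h : ∀ i, D.val i i * D.val (Fin.rev i) (Fin.rev i) - ζ ∈ fil F (2 * n + 1) 1) :
    ∃ e : Fˣ, ∃ u ∈ iwahoriPlusSubgroup F (2 * n + 1), ∃ t ∈ thetaTorus F n,
      HasDeg 0 t.val ∧ HasDeg 0 (t⁻¹).val ∧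
        D = Matrix.GeneralLinearGroup.scalar (Fin (2 * n + 1)) e * u * t := by
  have hprod : ∀ i, D.val i i * D.val (Fin.rev i) (Fin.rev i) ≠ 0 ∧
      ord (D.val i i * D.val (Fin.rev i) (Fin.rev i)) = 0 := by
    intro i
    rw [← hζ]
    refine ne_zero_and_ord_eq hζ0 ?_
    have := h i
    rw [mem_fil_iff_le_ord (e := 1) (by simp) (by simp)] at this
    rwa [hζ, Int.lt_iff_add_one_le, zero_add]
  have hD0 : ∀ i, D.val i i ≠ 0 := fun i => left_ne_zero_of_mul (hprod i).1
  have hDnn : ∀ i, 0 ≤ ord (D.val i i) := by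
    intro i
    have := hD i i
    rw [mem_fil_iff_le_ord (e := 0) (by simp; omega) (by simp)] at this
    exact this.resolve_left (hD0 i)
  have hD1 : ∀ i, ord (D.val i i) = 0 := by
    intro i
    have h1 := (hprod i).2
    rw [ord_mul (hD0 _) (hD0 _)] at h1
    have := hDnn i
    have := hDnn (Fin.rev i)
    omega
  set c : Fin (2 * n + 1) := ⟨n, by omega⟩ with hcdef
  have hc : Fin.rev c = c := by
    ext
    simp [hcdef, Fin.val_rev]
    omega
  -- The middle entry is the scalar to divide by: `c` is fixed by `rev`, so `e² ≡ ζ`.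
  set e := D.val c c with hedef
  have he0 : e ≠ 0 := hD0 c
  have he1 : ord e⁻¹ = 0 := by rw [ord_inv, hD1 c, neg_zero]
  have hde : ∀ i, D.val i i / e ≠ 0 ∧ ord (D.val i i / e) = 0 := fun i =>
    ⟨div_ne_zero (hD0 i) he0, by
      rw [div_eq_mul_inv, ord_mul (hD0 i) (inv_ne_zero he0), hD1, he1, add_zero]⟩
  choose s hs hsD using fun i => exists_teichmuller (hde i).1 (hde i).2
  have hsD' : ∀ i, (s i : F) - D.val i i / e ∈ fil F (2 * n + 1) 1 := fun i =>
    (mem_fil_iff_mem_primePow (by simp) (by simp)).mpr (hsD i)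
  set t : Fin n → Fˣ := fun i => s ⟨i, by omega⟩ with htdef
  have hsord : ∀ i, ord (s i : F) = 0 := fun i => ord_of_isOfFinOrder (hs i).1
  set v : Fin (2 * n + 1) → Fˣ := thetaVec t with hvdef
  have hvord : ∀ i, ord (v i : F) = 0 := by
    intro i
    simp only [hvdef, thetaVec]
    split_ifs
    · exact hsord _
    · simp
    · rw [Units.val_inv_eq_inv_val, ord_inv, hsord, neg_zero]
  have hvord' : ∀ i, ord ((v i : F)⁻¹) = 0 := fun i => by rw [ord_inv, hvord, neg_zero]
  have hcong : ∀ i, D.val i i * ((v i : F)⁻¹ * e⁻¹) - 1 ∈ fil F (2 * n + 1) 1 := by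
    intro i
    simp only [hvdef, thetaVec]
    split_ifs with h₁ h₂
    · have := mul_mem_fil_of_ord
        (show ord ((s i : F)⁻¹) = 0 by rw [ord_inv, hsord, neg_zero]) (hsD' i)
      convert neg_mem this using 1
      have := (s i).ne_zero
      field_simp
      ring
    · obtain rfl : i = c := Fin.ext h₂
      rw [Units.val_one, inv_one, one_mul, mul_inv_cancel₀ he0, sub_self]
      exact zero_mem _
    · have hi := i.isLt
      have hr : (⟨2 * n - i, by omega⟩ : Fin (2 * n + 1)) = Fin.rev i := by
        ext
        simp [Fin.val_rev]
      simp only [htdef, hr, Units.val_inv_eq_inv_val, inv_inv]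
      -- For lower indices the torus entry is the inverse of the lift at `rev i`. With `d = D.val i
      -- i`, `d' = D.val (rev i) (rev i)` and `s` that lift, `d s / e - 1` is `(d/e)(s - d'/e) + (d
      -- d' - ζ)/e² - (e² - ζ)/e²`.
      have h3 := mul_mem_fil_of_ord (hde i).2 (hsD' (Fin.rev i))
      have hee : ord (e⁻¹ * e⁻¹) = 0 := by
        rw [ord_mul (inv_ne_zero he0) (inv_ne_zero he0), he1, add_zero]
      have h4 := mul_mem_fil_of_ord hee (h i)
      have h5 := h c
      rw [hc, ← hedef] at h5
      replace h5 := mul_mem_fil_of_ord hee h5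
      convert sub_mem (add_mem h3 h4) h5 using 1
      field_simp
      ring
  have hv0 : ∀ i, (v i : F) ≠ 0 := fun i => (v i).ne_zero
  let T : GL (Fin (2 * n + 1)) F :=
    ⟨Matrix.diagonal fun i => (v i : F), Matrix.diagonal fun i => (v i : F)⁻¹,
      by simp [Matrix.diagonal_mul_diagonal], by simp [Matrix.diagonal_mul_diagonal]⟩
  have hT : HasDeg 0 T.val := by
    have := HasDeg.diagonal (N := 2 * n + 1) (r := 0) (d := fun i => (v i : F))
      fun i => Or.inr (hvord i).ge
    simpa using this
  have hT' : HasDeg 0 (T⁻¹).val := by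
    have := HasDeg.diagonal (N := 2 * n + 1) (r := 0) (d := fun i => (v i : F)⁻¹)
      fun i => Or.inr (hvord' i).ge
    rw [Nat.cast_add, mul_zero] at this
    exact this
  let E : Fˣ := Units.mk0 e he0
  set z := Matrix.GeneralLinearGroup.scalar (Fin (2 * n + 1)) E with hz
  refine ⟨E, z⁻¹ * D * T⁻¹, ?_, T, ⟨t, fun i => hs _, rfl⟩, hT, hT', by rw [← hz]; group⟩
  rw [mem_iwahoriPlusSubgroup]
  have hentry : ∀ i j, (z⁻¹ * D * T⁻¹).val i j = D.val i j * ((v j : F)⁻¹ * e⁻¹) := by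
    intro i j
    have hzv : (z⁻¹).val = Matrix.diagonal fun _ => e⁻¹ := by
      rw [hz, ← map_inv]
      rfl
    have hTv : (T⁻¹).val = Matrix.diagonal fun i => (v i : F)⁻¹ := rfl
    rw [Units.val_mul, Units.val_mul, hzv, hTv, Matrix.mul_diagonal, Matrix.diagonal_mul]
    ring
  intro i j
  rw [Matrix.sub_apply, hentry]
  by_cases hij : i = j
  · subst hij
    rw [Matrix.one_apply_eq]
    exact fil_mono (by simp) (hcong i)
  · rw [Matrix.one_apply_ne hij, sub_zero]
    have h1 : ord ((v j : F)⁻¹ * e⁻¹) = 0 := by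
      rw [ord_mul (inv_ne_zero (hv0 j)) (inv_ne_zero he0), hvord', he1, add_zero]
    rw [mul_comm (D.val i j)]
    exact mul_mem_fil_of_ord h1 (hD.mem_fil_of_ne hij)

end Torus

/-! ### Assembling the decomposition of `g`. -/

section Main

variable {F : Type*} [Field F] [ValuativeRel F] [TopologicalSpace F]
  [IsNonarchimedeanLocalField F] {N n : ℕ} {ϖ b : Fˣ}

theorem hasDeg_scalar (c : Fˣ) :
    HasDeg (N * ord (c : F)) (Matrix.GeneralLinearGroup.scalar (Fin N) c).val :=
  HasDeg.diagonal fun _ => Or.inr le_rfl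

theorem mem_extIwahoriPlus_iff {g : GL (Fin N) F} :
    g ∈ extIwahoriPlus N ϖ b ↔ ∃ c : Fˣ, ∃ u ∈ iwahoriPlusSubgroup F N, ∃ k : ℤ,
      g = Matrix.GeneralLinearGroup.scalar (Fin N) c * u * phi N ϖ b ^ k := by
  unfold extIwahoriPlus
  rw [Matrix.GeneralLinearGroup.center_eq_range_scalar]
  constructor
  · rintro ⟨_, ⟨_, ⟨c, rfl⟩, u, hu, rfl⟩, _, ⟨k, rfl⟩, rfl⟩
    exact ⟨c, u, mem_iwahoriPlus_iff.mp hu, k, rfl⟩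
  · rintro ⟨c, u, hu, k, rfl⟩
    exact ⟨_, ⟨_, ⟨c, rfl⟩, u, mem_iwahoriPlus_iff.mpr hu, rfl⟩, _, ⟨k, rfl⟩, rfl⟩

variable [CharP 𝓀[F] 2]

/-- Conjugating a product of a scalar, an element of `I⁺` and `φ ^ k` by `θ`-twisted powers of `φ`
gives a scalar of valuation zero times an element of `I⁺`. -/
theorem phi_twisted_conj_eq (h : ord ((ϖ * b : Fˣ) : F) = 1) {c : Fˣ} {u : GL (Fin N) F}
    (hu : u ∈ iwahoriPlusSubgroup F N) {k L : ℤ} (hL : N * ord (c : F) + k = 2 * L) :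
    ∃ ζ : Fˣ, ord (ζ : F) = 0 ∧ ∃ u' ∈ iwahoriPlusSubgroup F N,
      phi N ϖ b ^ (-L) * (Matrix.GeneralLinearGroup.scalar (Fin N) c * u * phi N ϖ b ^ k) *
        (theta (phi N ϖ b ^ (-L)))⁻¹ = Matrix.GeneralLinearGroup.scalar (Fin N) ζ * u' := by
  set r := ord (c : F) with hr
  have h₁ := phi_zpow_conj_mem (N := N) h (-L) hu
  have h₂ := phi_zpow_conj_mem (N := N) h (k - L) (theta_phi_zpow_mem (N := N) h (-L))
  -- Since `k - 2 * L = -N * r`, the leftover power of `φ` is the scalar `(ϖ * b) ^ (-r)`, which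
  -- cancels the valuation of `c`.
  refine ⟨c * (ϖ * b) ^ (-r), ?_, _, mul_mem h₁ h₂, ?_⟩
  · rw [Units.val_mul, ord_mul c.ne_zero (Units.ne_zero _), Units.val_zpow_eq_zpow_val, ord_zpow, h]
    omega
  · have e : phi N ϖ b ^ (k - 2 * L) =
        Matrix.GeneralLinearGroup.scalar (Fin N) ((ϖ * b) ^ (-r)) := by
      rw [map_zpow, ← phi_pow_card, ← zpow_natCast, ← zpow_mul]
      congr 1
      rw [mul_neg]
      omega
    calc _ = phi N ϖ b ^ (-L) * Matrix.GeneralLinearGroup.scalar (Fin N) c *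
          (u * phi N ϖ b ^ k * (theta (phi N ϖ b ^ (-L)))⁻¹) := by simp only [mul_assoc]
      _ = Matrix.GeneralLinearGroup.scalar (Fin N) c *
          (phi N ϖ b ^ (-L) * u * phi N ϖ b ^ k * (theta (phi N ϖ b ^ (-L)))⁻¹) := by
        rw [← scalar_mul_comm]
        simp only [mul_assoc]
      _ = Matrix.GeneralLinearGroup.scalar (Fin N) c *
          (phi N ϖ b ^ (-L) * u * (phi N ϖ b ^ (-L))⁻¹ * (phi N ϖ b ^ (k - L) *
            ((theta (phi N ϖ b ^ (-L)))⁻¹ * (phi N ϖ b ^ (-L))⁻¹) * (phi N ϖ b ^ (k - L))⁻¹) *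
              phi N ϖ b ^ (k - 2 * L)) := by
        congr 1
        generalize (theta (phi N ϖ b ^ (-L)))⁻¹ = ψ
        group
      _ = _ := by rw [map_mul, e, ← scalar_mul_comm, ← mul_assoc]
/-- Up to the group `Z I⁺ ⟨φ⟩`, an element of `GL_N(F)` that carries a `θ`-affine generic element
into `Z I⁺ ⟨φ⟩` by `θ`-twisted conjugation lies in `T^θ(q)`. -/
theorem mem_extIwahoriPlus_mul_thetaTorus (hϖb : ord ((ϖ * b : Fˣ) : F) = 1)
    {x g : GL (Fin (2 * n + 1)) F} (hx : IsThetaAffineGeneric n x)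
    (hg : g * x * (theta g)⁻¹ ∈ extIwahoriPlus (2 * n + 1) ϖ b) :
    g ∈ extIwahoriPlus (2 * n + 1) ϖ b * thetaTorus F n := by
  obtain ⟨u₁, hu₁, u₂, hu₂, σ, hm⟩ := exists_monomial g
  obtain ⟨c, u, hu, k, hg⟩ := mem_extIwahoriPlus_iff.mp hg
  set φ := phi (2 * n + 1) ϖ b with hφ
  set m := u₁ * g * u₂ with hmdef
  set z := Matrix.GeneralLinearGroup.scalar (Fin (2 * n + 1)) c with hz
  obtain ⟨x', hx'def⟩ : ∃ x', x' = u₂⁻¹ * x * (theta u₂⁻¹)⁻¹ := ⟨_, rfl⟩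
  have hx' : IsThetaAffineGeneric n x' := hx'def ▸ hx.twisted_conj (inv_mem hu₂)
  have hx'I : x' ∈ iwahoriPlusSubgroup F (2 * n + 1) := mem_iwahoriPlus_iff.mp hx'.1
  -- `w` collects the `I⁺` factors once `(theta u₁)⁻¹` is moved to the left of `φ ^ k`.
  set w := u₁ * u * (φ ^ k * (theta u₁)⁻¹ * (φ ^ k)⁻¹) with hwdef
  have hw : w ∈ iwahoriPlusSubgroup F (2 * n + 1) :=
    mul_mem (mul_mem hu₁ hu)
      (phi_zpow_conj_mem hϖb k (inv_mem (theta_mem_iwahoriPlusSubgroup hu₁)))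
  have hy : m * x' * (theta m)⁻¹ = z * w * φ ^ k := by
    calc _ = u₁ * (g * x * (theta g)⁻¹) * (theta u₁)⁻¹ := by
          rw [hmdef, hx'def, theta_mul, theta_mul, theta_inv]
          group
      _ = u₁ * z * (u * φ ^ k * (theta u₁)⁻¹) := by
          rw [hg]
          simp only [mul_assoc]
      _ = z * w * φ ^ k := by
          rw [hz, ← scalar_mul_comm, hwdef]
          group
  have hdeg : HasDeg ((2 * n + 1 : ℕ) * ord (c : F) + k) (m * x' * (theta m)⁻¹).val := by
    rw [hy, Units.val_mul, Units.val_mul]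
    exact (((hasDeg_scalar c).mul hw.of_sub_one).mul (hasDeg_phi_zpow hϖb k)).mono (by simp)
  have hdeg' : HasDeg (-((2 * n + 1 : ℕ) * ord (c : F) + k)) ((m * x' * (theta m)⁻¹)⁻¹).val := by
    rw [hy, mul_inv_rev, mul_inv_rev, Units.val_mul, Units.val_mul, ← zpow_neg, hz, ← map_inv]
    have h₁ := hasDeg_scalar (N := 2 * n + 1) c⁻¹
    rw [Units.val_inv_eq_inv_val, ord_inv, mul_neg] at h₁
    exact ((hasDeg_phi_zpow hϖb (-k)).mul (hw.inv_sub_one.of_sub_one.mul h₁)).mono (by omega)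
  obtain ⟨L, hL, hmL⟩ := exists_hasDeg_of_generic hm hx' hdeg hdeg'
  obtain ⟨ζ, hζ, v, hv, hζv⟩ := phi_twisted_conj_eq (N := 2 * n + 1) hϖb hw hL
  rw [← hφ, ← hz, ← hy] at hζv
  obtain ⟨D, hDdef⟩ : ∃ D, D = φ ^ (-L) * m := ⟨_, rfl⟩
  have hD : HasDeg 0 D.val := by
    rw [hDdef, Units.val_mul]
    exact ((hasDeg_phi_zpow hϖb (-L)).mul hmL).mono (by simp)
  have hDx : D * x' * (theta D)⁻¹ = Matrix.GeneralLinearGroup.scalar (Fin (2 * n + 1)) ζ * v := by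
    rw [← hζv, hDdef, theta_mul]
    group
  have hdiag : ∀ i, D.val i i * D.val (Fin.rev i) (Fin.rev i) - ζ ∈ fil F (2 * n + 1) 1 := by
    intro i
    have hscal : HasDeg 0 (Matrix.GeneralLinearGroup.scalar (Fin (2 * n + 1)) ζ).val := by
      simpa [hζ] using hasDeg_scalar (N := 2 * n + 1) ζ
    -- Isolating the leading parts of `x'` and `v` leaves only terms of degree at least 1, so `D *
    -- tau D` is the scalar `ζ` modulo degree 1.
    have e : D.val * tau D.val - (Matrix.GeneralLinearGroup.scalar (Fin (2 * n + 1)) ζ).val =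
        (Matrix.GeneralLinearGroup.scalar (Fin (2 * n + 1)) ζ).val * (v.val - 1) -
          D.val * (x'.val - 1) * tau D.val := by
      have := congrArg Units.val hDx
      rw [Units.val_mul, Units.val_mul, Units.val_mul, val_theta_inv] at this
      rw [mul_sub, mul_sub, sub_mul, this, mul_one, mul_one]
      abel
    have h₁ : HasDeg 1 (D.val * tau D.val -
        (Matrix.GeneralLinearGroup.scalar (Fin (2 * n + 1)) ζ).val) := by
      rw [e]
      exact ((hscal.mul hv).mono (by simp)).sub (((hD.mul hx'I).mul hD.tau).mono (by simp))
    have h₂ := sub_mem (fil_mono (c := 1) (by simp) (h₁ i i)) (hD.mul_diag_sub_mem hD.tau i)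
    rw [tau_apply, Even.neg_one_pow ⟨_, rfl⟩, one_mul, Matrix.sub_apply] at h₂
    convert h₂ using 1
    simp
  obtain ⟨e, d, hd, t, ht, ht₀, ht₁, hDe⟩ := exists_thetaTorus_of_diag hD ζ.ne_zero hζ hdiag
  -- From `g = u₁⁻¹ φ^L (e d t) u₂⁻¹`, move `t` to the far right and `φ^L` past the `I⁺` factors;
  -- conjugation by either preserves `I⁺`.
  refine ⟨_, mem_extIwahoriPlus_iff.mpr ⟨e, _, mul_mem (inv_mem hu₁) (phi_zpow_conj_mem hϖb L
    (mul_mem hd (conj_mem_iwahoriPlusSubgroup ht₀ ht₁ le_rfl (inv_mem hu₂)))), L, rfl⟩, t, ht, ?_⟩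
  rw [← hφ]
  have hgD : g = u₁⁻¹ * φ ^ L * D * u₂⁻¹ := by
    rw [hDdef, hmdef]
    group
  calc _ = Matrix.GeneralLinearGroup.scalar (Fin (2 * n + 1)) e * (u₁⁻¹ * φ ^ L) *
        (d * t * u₂⁻¹) := by group
    _ = u₁⁻¹ * φ ^ L * D * u₂⁻¹ := by
      rw [scalar_mul_comm, hDe]
      simp only [mul_assoc]
    _ = g := hgD.symm

end Main

end ThetaNorm

theorem proposition3p8 {F : Type*} [Field F] [ValuativeRel F] [TopologicalSpace F]
    [IsNonarchimedeanLocalField F] [CharZero F] [CharP 𝓀[F] 2]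
    (n : ℕ) (ϖ : Fˣ) (hϖ : ThetaNorm.IsUniformizer (ϖ : F))
    (a : Fˣ) (ha : a ∈ ThetaNorm.teichmullerUnits F)
    (x : GL (Fin (2 * n + 1)) F) (hx : ThetaNorm.IsThetaAffineGeneric n x)
    (g : GL (Fin (2 * n + 1)) F)
    (hg : g * x * (ThetaNorm.theta g)⁻¹ ∈ ThetaNorm.extIwahoriPlus (2 * n + 1) ϖ a⁻¹) :
    g ∈ ThetaNorm.extIwahoriPlus (2 * n + 1) ϖ a⁻¹ * ThetaNorm.thetaTorus F n := by
  refine ThetaNorm.mem_extIwahoriPlus_mul_thetaTorus ?_ hx hg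
  rw [Units.val_mul, ThetaNorm.ord_mul ϖ.ne_zero (Units.ne_zero _),
    ThetaNorm.ord_of_isUniformizer hϖ, ThetaNorm.ord_of_isOfFinOrder (inv_mem ha).1, add_zero]
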